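/- Let $n\ge 1$, let $K$ be an extension field of $\mathbb C$ (for instance $\mathbb C(q^{1/2})$ or $\mathbb C(q^{1/2},x,y)$), $i=\sqrt{-1}$, and let $q^{1/2}\in K$ be nonzero and not a root of unity. Put $[m]=\frac{q^m-q^{-m}}{q-q^{-1}}$, $[m]!=[1]\cdots[m]$, ${l\brack k}=\frac{[l]!}{[k]!\,[l-k]!}$ and $\kappa=\frac{q+1}{q-1}$. Let $V=\bigoplus_{\mathbf m\in(\mathbb Z_{\ge0})^n}K|\mathbf m\rangle$ and let $\mathbf e_j$ be the $j$-th unit vector of $\mathbb Z^n$. For $x\in K^\times$ let $V_x=V$ be the $q$-oscillator representation of $U_q(D^{(2)}_{n+1})$, on which the generators $e_r,f_r,k_r^{\pm1}$ $(0\le r\le n)$ act by $$e_0|\mathbf m\rangle=x|\mathbf m+\mathbf e_1\rangle,\quad f_0|\mathbf m\rangle=i\kappa[m_1]x^{-1}|\mathbf m-\mathbf e_1\rangle,\quad k_0|\mathbf m\rangle=-iq^{m_1+\frac12}|\mathbf m\rangle,$$ $$e_j|\mathbf m\rangle=[m_j]|\mathbf m-\mathbf e_j+\mathbf e_{j+1}\rangle,\quad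 f_j|\mathbf m\rangle=[m_{j+1}]|\mathbf m+\mathbf e_j-\mathbf e_{j+1}\rangle,\quad k_j|\mathbf m\rangle=q^{-m_j+m_{j+1}}|\mathbf m\rangle\quad(1\le j\le n-1),$$ $$e_n|\mathbf m\rangle=i\kappa[m_n]|\mathbf m-\mathbf e_n\rangle,\quad f_n|\mathbf m\rangle=|\mathbf m+\mathbf e_n\rangle,\quad k_n|\mathbf m\rangle=iq^{-m_n-\frac12}|\mathbf m\rangle.$$ Let $\Delta k_r=k_r\otimes k_r$, $\Delta e_r=1\otimes e_r+e_r\otimes k_r$, $\Delta f_r=f_r\otimes1+k_r^{-1}\otimes f_r$, let $P(u\otimes v)=v\otimes u$, and let $\Delta'=P\circ\Delta$ be the opposite coproduct. Let $x,y\in K^\times$ and $z=x/y$, and assume $1+q^jz\ne0$ for all $j\ge1$. The quantum $R$ matrix $R(z)$ is the operator $R\in\mathrm{End}(V_x\otimes V_y)$ such that $\Delta'(g)R=R\,\Delta(g)$ for $g=e_r,f_r,k_r$ $(0\le r\le n)$ and $R(|\mathbf 0\rangle\otimes|\mathbf 0\rangle)=|\mathbf 0\rangle\otimes|\mathbf 0\rangle$.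 For $l\ge0$ let $$v_l=\sum_{k=0}^l i^kq^{lk-k^2/2}{l\brack k}\,|k\mathbf e_n\rangle\otimes|(l-k)\mathbf e_n\rangle,$$ and let $V_l\subset V\otimes V$ be the subspace generated from $v_l$ by (the coproducts of) $f_1,\dots,f_n$, i.e. the smallest subspace that contains $v_l$ and is stable under $\Delta f_1,\dots,\Delta f_n$. Then $R(z)$ exists and is unique, $V\otimes V=\bigoplus_{l\ge0}V_l$, and $$PR(z)=\sum_{l=0}^\infty\ \prod_{j=1}^l\frac{z+q^j}{1+q^jz}\;P_l,$$ where $P_l$ is the projector onto $V_l$ along $\bigoplus_{k\ne l}V_k$ (on each vector, only finitely many terms of the sum are nonzero). -/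

import Mathlib

open scoped TensorProduct

noncomputable section

namespace QOsc

variable {K : Type*} [Field K]

/-! ### Notation. The scalar `s` plays the role of `q ^ (1/2)`, so that `q = s ^ 2`. -/

/-- The quantum integer `[m] = (q ^ m - q ^ (-m)) / (q - q ^ (-1))` with `q = s ^ 2`. -/
def qInt (s : K) (m : ℕ) : K :=
  ((s ^ 2) ^ m - ((s ^ 2) ^ m)⁻¹) / (s ^ 2 - (s ^ 2)⁻¹)

/-- `[m]! = [1] [2] ⋯ [m]`. -/
def qFactorial (s : K) (m : ℕ) : K :=
  ∏ k ∈ Finset.range m, qInt s (k + 1)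

/-- `[m]! / ([k]! [m - k]!)`, and zero unless `k ≤ m`. -/
def qBinom (s : K) (m k : ℕ) : K :=
  if k ≤ m then qFactorial s m / (qFactorial s k * qFactorial s (m - k)) else 0

/-- `κ = (q + 1) / (q - 1)`. -/
def kappa (s : K) : K := (s ^ 2 + 1) / (s ^ 2 - 1)

/-- The imaginary unit in an extension field of `ℂ`. -/
def imI (K : Type*) [Field K] [Algebra ℂ K] : K := algebraMap ℂ K Complex.I

/-! ### The Fock space -/

/-- The `n`-fold tensor power of `⨁_{m ≥ 0} K |m⟩`, through its basis
`|𝐦⟩ = |m₁⟩ ⊗ ⋯ ⊗ |mₙ⟩` indexed by `𝐦 ∈ ℕⁿ`. -/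
abbrev Fock (K : Type*) [Field K] (n : ℕ) : Type _ := (Fin n → ℕ) →₀ K

/-- The basis vector `|𝐦⟩`. -/
def ket (K : Type*) [Field K] {n : ℕ} (m : Fin n → ℕ) : Fock K n := Finsupp.single m 1

/-- The component `m_j` of `𝐦 = (m₁, …, mₙ)`, where `1 ≤ j ≤ n`. -/
def site {n : ℕ} (m : Fin n → ℕ) (j : ℕ) : ℕ :=
  if h : 1 ≤ j ∧ j ≤ n then m ⟨j - 1, by omega⟩ else 0

/-- The vector `𝐞_j = (0, …, 1, …, 0)` with `1` in the `j`-th place, where `1 ≤ j ≤ n`. -/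
def unitVec (n j : ℕ) : Fin n → ℕ := fun a => if (a : ℕ) + 1 = j then 1 else 0

/-- The linear operator with `|𝐦⟩ ↦ c 𝐦 |φ 𝐦⟩`. -/
def ketOp {n : ℕ} (c : (Fin n → ℕ) → K) (φ : (Fin n → ℕ) → (Fin n → ℕ)) :
    Module.End K (Fock K n) :=
  Finsupp.linearCombination K fun m => c m • ket K (φ m)

section rep

variable [Algebra ℂ K]

/-! ### The `q`-oscillator representation of `U_q(D^{(2)}_{n+1})`

The vertices of the Dynkin diagram are `r = 0, …, n` with `n ≥ 1`, and `x` is the spectral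
parameter. A ket with a negative entry never occurs with a nonzero coefficient, because
`[0] = 0`. Only the operators with `r = 0` depend on `x`. -/

/-- The action of `e_r`. -/
def opE (n : ℕ) (s x : K) (r : ℕ) : Module.End K (Fock K n) :=
  if r = 0 then ketOp (fun _ => x) (fun m => m + unitVec n 1)
  else if r = n then
    ketOp (fun m => imI K * kappa s * qInt s (site m n)) (fun m => m - unitVec n n)
  else ketOp (fun m => qInt s (site m r)) (fun m => m - unitVec n r + unitVec n (r + 1))

/-- The action of `f_r`. -/
def opF (n : ℕ) (s x : K) (r : ℕ) : Module.End K (Fock K n) :=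
  if r = 0 then
    ketOp (fun m => imI K * kappa s * qInt s (site m 1) * x⁻¹) (fun m => m - unitVec n 1)
  else if r = n then ketOp (fun _ => 1) (fun m => m + unitVec n n)
  else ketOp (fun m => qInt s (site m (r + 1)))
    (fun m => m + unitVec n r - unitVec n (r + 1))

/-- The eigenvalue of `k_r` on `|𝐦⟩`: it is `-i q ^ (m₁ + 1/2)` for `r = 0`,
`i q ^ (-mₙ - 1/2)` for `r = n` and `q ^ (-m_r + m_{r+1})` for `0 < r < n`. -/
def kVal (n : ℕ) (s : K) (r : ℕ) (m : Fin n → ℕ) : K :=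
  if r = 0 then -(imI K * s ^ (2 * site m 1 + 1))
  else if r = n then imI K * (s ^ (2 * site m n + 1))⁻¹
  else (s ^ 2) ^ (-(site m r : ℤ) + (site m (r + 1) : ℤ))

/-- The action of `k_r`. -/
def opK (n : ℕ) (s : K) (r : ℕ) : Module.End K (Fock K n) :=
  ketOp (kVal n s r) id

/-- The action of the inverse of `k_r`. -/
def opKinv (n : ℕ) (s : K) (r : ℕ) : Module.End K (Fock K n) :=
  ketOp (fun m => (kVal n s r m)⁻¹) id

/-! ### The quantum `R` matrix -/

/-- `R ∈ End(V_x ⊗ V_y)` is the quantum `R` matrix of the `q`-oscillator representation of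
`U_q(D^{(2)}_{n+1})`: `Δ'(g) R = R Δ(g)` for the generators `g = k_r, e_r, f_r` (`0 ≤ r ≤ n`),
with `Δ k_r = k_r ⊗ k_r`, `Δ e_r = 1 ⊗ e_r + e_r ⊗ k_r`, `Δ f_r = f_r ⊗ 1 + k_r⁻¹ ⊗ f_r` and
`Δ'` the opposite coproduct, and `R (|𝟎⟩ ⊗ |𝟎⟩) = |𝟎⟩ ⊗ |𝟎⟩`. -/
structure IsQuantumR (n : ℕ) (s x y : K) (R : Module.End K (Fock K n ⊗[K] Fock K n)) :
    Prop where
  k_comm : ∀ r ≤ n,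
    TensorProduct.map (opK n s r) (opK n s r) ∘ₗ R =
      R ∘ₗ TensorProduct.map (opK n s r) (opK n s r)
  e_comm : ∀ r ≤ n,
    (TensorProduct.map (opE n s x r) LinearMap.id +
        TensorProduct.map (opK n s r) (opE n s y r)) ∘ₗ R =
      R ∘ₗ (TensorProduct.map LinearMap.id (opE n s y r) +
        TensorProduct.map (opE n s x r) (opK n s r))
  f_comm : ∀ r ≤ n,
    (TensorProduct.map LinearMap.id (opF n s y r) +
        TensorProduct.map (opF n s x r) (opKinv n s r)) ∘ₗ R =
      R ∘ₗ (TensorProduct.map (opF n s x r) LinearMap.id +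
        TensorProduct.map (opKinv n s r) (opF n s y r))
  normalized : R (ket K 0 ⊗ₜ[K] ket K 0) = ket K 0 ⊗ₜ[K] ket K 0

/-- `P R`, where `P (u ⊗ v) = v ⊗ u`. -/
def swapComp {n : ℕ} (R : Module.End K (Fock K n ⊗[K] Fock K n)) :
    Module.End K (Fock K n ⊗[K] Fock K n) :=
  (TensorProduct.comm K (Fock K n) (Fock K n)).toLinearMap ∘ₗ R

/-! ### The components `V_l` -/

/-- The singular vector
`v_l = ∑_{k = 0}^{l} i ^ k q ^ (l k - k² / 2) [l; k] |k 𝐞ₙ⟩ ⊗ |(l - k) 𝐞ₙ⟩`. -/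
def singularVec (n : ℕ) (s : K) (l : ℕ) : Fock K n ⊗[K] Fock K n :=
  ∑ k ∈ Finset.range (l + 1),
    (imI K ^ k * s ^ (2 * (l : ℤ) * (k : ℤ) - (k : ℤ) ^ 2) * qBinom s l k) •
      (ket K (k • unitVec n n) ⊗ₜ[K] ket K ((l - k) • unitVec n n))

/-- The action of `Δ f_r = f_r ⊗ 1 + k_r⁻¹ ⊗ f_r` for `1 ≤ r ≤ n`, where there is no dependence
on the spectral parameters, which are therefore set to `1`. -/
def coprodF (n : ℕ) (s : K) (r : ℕ) : Module.End K (Fock K n ⊗[K] Fock K n) :=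
  TensorProduct.map (opF n s 1 r) LinearMap.id +
    TensorProduct.map (opKinv n s r) (opF n s 1 r)

/-- `V_l`, the subspace generated by `f_1, …, f_n` from the singular vector `v_l`. -/
def component (n : ℕ) (s : K) (l : ℕ) : Submodule K (Fock K n ⊗[K] Fock K n) :=
  sInf {W | singularVec n s l ∈ W ∧
    ∀ r, 1 ≤ r → r ≤ n → ∀ w ∈ W, coprodF n s r w ∈ W}

end rep

/-- The projector onto the summand `W l` of an internal direct sum `M = ⨁ l, W l`. -/
def projector {M : Type*} [AddCommMonoid M] [Module K M] {W : ℕ → Submodule K M}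
    (hW : DirectSum.IsInternal W) (l : ℕ) : Module.End K M :=
  (W l).subtype ∘ₗ DirectSum.component K ℕ (fun l => W l) l ∘ₗ
    (LinearEquiv.ofBijective (DirectSum.coeLinearMap W) hW).symm.toLinearMap

/-- `ρ_l(z) = ∏_{j = 1}^{l} (z + q ^ j) / (1 + q ^ j z)`. -/
def rho (s z : K) (l : ℕ) : K :=
  ∏ j ∈ Finset.Icc 1 l, (z + (s ^ 2) ^ j) / (1 + (s ^ 2) ^ j * z)

end QOsc

end

noncomputable section

namespace QOsc

variable {K : Type*} [Field K]

/-! ### Scalars -/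

section scalars

variable {s : K}

/-! Put T = PR. Since P turns Δ' into Δ with the two spectral parameters interchanged, R is the
quantum R matrix exactly when T intertwines V_x ⊗ V_y with V_y ⊗ V_x and fixes |0⟩ ⊗ |0⟩
(`IsIntertwiner`). Only e_0 and f_0 see the parameters, so T commutes with e_r and f_r for r ≥ 1.

On V_l, which is generated by f_1, …, f_n from one vector, T is determined by its value on that
vector. Different l are linked by e_0, which commutes with these f_r. Its two terms, creation in the
left or the right factor, combine into `upVec` in V_{l+1} and `downVec` in V_{l-1} (in V_0 if l =
0), and up to a nonzero scalar e_0 v_l = q^{-l} (y + q^{l+1} x) up − (x + q^l y) down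
(`copE_zero_vhat`). Exchanging x and y forces ρ_{l+1} (y + q^{l+1} x) = ρ_l (x + q^{l+1} y), and
v_{l+1} is recovered from `upVec` by raising operators. This gives uniqueness and the eigenvalue on
V_l (`intertwiner_vhat`) without any irreducibility argument.

The analogous vectors at every site j show that the V_l span: creation at site j preserves the span
of everything generated from the v_l by f_j, …, f_n, so all kets are reached site by site
(`ket_mem_genSub`, `iSup_component`). The sum is direct because of a contravariant form: kets are
orthogonal with nonzero length, e_r is transposed to a multiple of f_r k_r, and since each v_l is
killed by e_r for r ≥ 1 (`copE_vhat`), the V_l are pairwise orthogonal (`form₂_component`,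
`isInternal_component`).

For existence, let T act on V_l by ρ_l. It commutes with whatever preserves every V_l; the recursion
handles e_0 (`spectralOp_copE_zero`); and f_0 follows by transposition, because T is self-adjoint
(`spectralOp_copF_zero`). -/

lemma sq_pow_ne_one (hgen : ∀ k : ℕ, 0 < k → s ^ k ≠ 1) {m : ℕ} (hm : 0 < m) :
    (s ^ 2) ^ m ≠ 1 := by
  rw [← pow_mul]
  exact hgen _ (by omega)

lemma sq_sub_inv_ne_zero (hs : s ≠ 0) (hgen : ∀ k : ℕ, 0 < k → s ^ k ≠ 1) :
    s ^ 2 - (s ^ 2)⁻¹ ≠ 0 := by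
  intro h
  have h4 : s ^ 4 = 1 := by
    field_simp at h
    linear_combination h
  exact hgen 4 (by norm_num) h4

lemma sq_sub_one_ne_zero (hgen : ∀ k : ℕ, 0 < k → s ^ k ≠ 1) : s ^ 2 - 1 ≠ 0 :=
  sub_ne_zero.mpr (hgen 2 (by norm_num))

lemma sq_add_one_ne_zero (hgen : ∀ k : ℕ, 0 < k → s ^ k ≠ 1) : s ^ 2 + 1 ≠ 0 := by
  intro h
  exact hgen 4 (by norm_num) (by linear_combination (s ^ 2 - 1) * h)

lemma kappa_ne_zero (hgen : ∀ k : ℕ, 0 < k → s ^ k ≠ 1) : kappa s ≠ 0 :=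
  div_ne_zero (sq_add_one_ne_zero hgen) (sq_sub_one_ne_zero hgen)

@[simp] lemma qInt_zero (s : K) : qInt s 0 = 0 := by simp [qInt]

lemma qInt_one (hs : s ≠ 0) (hgen : ∀ k : ℕ, 0 < k → s ^ k ≠ 1) : qInt s 1 = 1 := by
  simp only [qInt, pow_one]
  exact div_self (sq_sub_inv_ne_zero hs hgen)

lemma qInt_ne_zero (hs : s ≠ 0) (hgen : ∀ k : ℕ, 0 < k → s ^ k ≠ 1) {m : ℕ} (hm : 0 < m) :
    qInt s m ≠ 0 := by
  refine div_ne_zero ?_ (sq_sub_inv_ne_zero hs hgen)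
  intro h
  have hq : (s ^ 2) ^ m ≠ 0 := pow_ne_zero _ (pow_ne_zero _ hs)
  field_simp at h
  refine sq_pow_ne_one hgen (m := 2 * m) (by omega) ?_
  rw [mul_comm, pow_mul]
  linear_combination h

lemma qFactorial_succ (s : K) (m : ℕ) :
    qFactorial s (m + 1) = qFactorial s m * qInt s (m + 1) := Finset.prod_range_succ _ _

@[simp] lemma qFactorial_zero (s : K) : qFactorial s 0 = 1 := by simp [qFactorial]

lemma qFactorial_ne_zero (hs : s ≠ 0) (hgen : ∀ k : ℕ, 0 < k → s ^ k ≠ 1) (m : ℕ) :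
    qFactorial s m ≠ 0 :=
  Finset.prod_ne_zero_iff.mpr fun _ _ => qInt_ne_zero hs hgen (Nat.succ_pos _)

lemma imI_sq [Algebra ℂ K] : imI K * imI K = -1 := by
  rw [imI, ← map_mul, Complex.I_mul_I]
  simp

lemma imI_ne_zero [Algebra ℂ K] : imI K ≠ 0 := by
  intro h
  have := imI_sq (K := K)
  simp [h] at this

end scalars

/-! ### Sites and unit vectors -/

section sites

variable {n : ℕ}

@[simp] lemma site_add (m m' : Fin n → ℕ) (j : ℕ) : site (m + m') j = site m j + site m' j := by
  unfold site
  split_ifs <;> simp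

@[simp] lemma site_smul (a : ℕ) (m : Fin n → ℕ) (j : ℕ) : site (a • m) j = a * site m j := by
  unfold site
  split_ifs <;> simp

@[simp] lemma site_sub (m m' : Fin n → ℕ) (j : ℕ) : site (m - m') j = site m j - site m' j := by
  unfold site
  split_ifs <;> simp

@[simp] lemma site_zero (j : ℕ) : site (0 : Fin n → ℕ) j = 0 := by
  unfold site
  split_ifs <;> simp

lemma site_unitVec (i j : ℕ) :
    site (unitVec n j) i = if i = j ∧ 1 ≤ i ∧ i ≤ n then 1 else 0 := by
  unfold site unitVec
  split_ifs <;> first | rfl | (simp at *; omega)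

lemma site_unitVec_self {j : ℕ} (h1 : 1 ≤ j) (h2 : j ≤ n) : site (unitVec n j) j = 1 := by
  simp [site_unitVec, h1, h2]

lemma site_unitVec_ne {i j : ℕ} (h : i ≠ j) : site (unitVec n j) i = 0 := by
  simp [site_unitVec, h]

lemma ext_site {m m' : Fin n → ℕ} (h : ∀ j, 1 ≤ j → j ≤ n → site m j = site m' j) : m = m' := by
  funext a
  have := h (a + 1) (by omega) (by omega)
  simpa [site, show (a : ℕ) + 1 ≤ n by omega] using this

lemma unitVec_le {m : Fin n → ℕ} {j : ℕ} (h : site m j ≠ 0) : unitVec n j ≤ m := by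
  intro a
  unfold unitVec
  split_ifs with ha
  · subst ha
    have : site m (a + 1) = m a := by simp [site, show (a : ℕ) + 1 ≤ n by omega]
    exact Nat.one_le_iff_ne_zero.mpr (this ▸ h)
  · exact Nat.zero_le _

end sites

/-! ### Creation, annihilation and diagonal operators -/

section single

variable {n : ℕ}

@[simp] lemma ketOp_ket (c : (Fin n → ℕ) → K) (φ : (Fin n → ℕ) → (Fin n → ℕ))
    (m : Fin n → ℕ) : ketOp c φ (ket K m) = c m • ket K (φ m) := by
  simp [ketOp, ket]

lemma fock_ext {M : Type*} [AddCommMonoid M] [Module K M] {f g : Fock K n →ₗ[K] M}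
    (h : ∀ m, f (ket K m) = g (ket K m)) : f = g :=
  Finsupp.lhom_ext' fun m => LinearMap.ext_ring (h m)

lemma tensor_ext {M : Type*} [AddCommMonoid M] [Module K M]
    {f g : Fock K n ⊗[K] Fock K n →ₗ[K] M}
    (h : ∀ m m', f (ket K m ⊗ₜ ket K m') = g (ket K m ⊗ₜ ket K m')) : f = g :=
  TensorProduct.ext (fock_ext fun m => fock_ext fun m' => h m m')

/-- The creation operator at the site `j`. -/
def cre (K : Type*) [Field K] (n j : ℕ) : Module.End K (Fock K n) :=
  ketOp (fun _ => 1) (fun m => m + unitVec n j)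

/-- The annihilation operator at the site `j`. -/
def ann (n : ℕ) (s : K) (j : ℕ) : Module.End K (Fock K n) :=
  ketOp (fun m => qInt s (site m j)) (fun m => m - unitVec n j)

/-- The diagonal operator with eigenvalues `χ`. -/
def dg (χ : (Fin n → ℕ) → K) : Module.End K (Fock K n) := ketOp χ id

@[simp] lemma cre_ket (j : ℕ) (m : Fin n → ℕ) :
    cre K n j (ket K m) = ket K (m + unitVec n j) := by
  simp [cre]

@[simp] lemma ann_ket (s : K) (j : ℕ) (m : Fin n → ℕ) :
    ann n s j (ket K m) = qInt s (site m j) • ket K (m - unitVec n j) := by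
  simp [ann]

@[simp] lemma dg_ket (χ : (Fin n → ℕ) → K) (m : Fin n → ℕ) :
    dg χ (ket K m) = χ m • ket K m := by
  simp [dg]

lemma cre_comm (i j : ℕ) : Commute (cre K n i) (cre K n j) := by
  refine fock_ext fun m => ?_
  simp [add_right_comm]

lemma ann_comm (s : K) (i j : ℕ) : Commute (ann n s i) (ann n s j) := by
  rcases eq_or_ne i j with rfl | hij
  · exact Commute.refl _
  refine fock_ext fun m => ?_
  simp [smul_smul, site_unitVec_ne hij, site_unitVec_ne hij.symm, tsub_right_comm, mul_comm]

lemma ann_cre_comm (s : K) {i j : ℕ} (hij : i ≠ j) : Commute (ann n s i) (cre K n j) := by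
  refine fock_ext fun m => ?_
  simp only [Module.End.mul_apply, cre_ket, ann_ket, map_smul, site_add, site_unitVec_ne hij,
    add_zero]
  -- Subtraction is truncated, so it commutes with the addition only when m_i > 0; otherwise the
  -- coefficient [0] vanishes. The same split recurs below.
  by_cases h : site m i = 0
  · simp [h]
  · rw [tsub_add_eq_add_tsub (unitVec_le h)]

lemma ann_mul_cre (s : K) {j : ℕ} (h1 : 1 ≤ j) (h2 : j ≤ n) :
    ann n s j * cre K n j = dg fun m => qInt s (site m j + 1) := by
  refine fock_ext fun m => ?_
  simp [site_unitVec_self h1 h2]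

lemma cre_mul_ann (s : K) (j : ℕ) :
    cre K n j * ann n s j = dg fun m => qInt s (site m j) := by
  refine fock_ext fun m => ?_
  simp only [Module.End.mul_apply, cre_ket, ann_ket, map_smul, dg_ket]
  by_cases h : site m j = 0
  · simp [h]
  · rw [tsub_add_cancel_of_le (unitVec_le h)]

lemma dg_mul_dg (χ ψ : (Fin n → ℕ) → K) : dg χ * dg ψ = dg fun m => χ m * ψ m := by
  refine fock_ext fun m => ?_
  simp [smul_smul, mul_comm]

/-- `χ` is multiplied by `t j` when a particle is added at the site `j`. -/
def HasShift (χ : (Fin n → ℕ) → K) (t : ℕ → K) : Prop :=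
  ∀ j, 1 ≤ j → j ≤ n → t j ≠ 0 ∧ ∀ m, χ (m + unitVec n j) = t j * χ m

lemma HasShift.inv {χ : (Fin n → ℕ) → K} {t : ℕ → K} (h : HasShift χ t) :
    HasShift (fun m => (χ m)⁻¹) (fun j => (t j)⁻¹) := fun j h1 h2 =>
  ⟨inv_ne_zero (h j h1 h2).1, fun m => by simp only [(h j h1 h2).2, mul_inv]⟩

lemma HasShift.dg_mul_cre {χ : (Fin n → ℕ) → K} {t : ℕ → K} (h : HasShift χ t) {j : ℕ}
    (h1 : 1 ≤ j) (h2 : j ≤ n) : dg χ * cre K n j = t j • (cre K n j * dg χ) := by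
  refine fock_ext fun m => ?_
  simp [(h j h1 h2).2, smul_smul]

lemma HasShift.dg_mul_ann {χ : (Fin n → ℕ) → K} {t : ℕ → K} (h : HasShift χ t) (s : K) {j : ℕ}
    (h1 : 1 ≤ j) (h2 : j ≤ n) : dg χ * ann n s j = (t j)⁻¹ • (ann n s j * dg χ) := by
  refine fock_ext fun m => ?_
  simp only [Module.End.mul_apply, ann_ket, dg_ket, map_smul, LinearMap.smul_apply, smul_smul]
  by_cases hm : site m j = 0
  · simp [hm]
  · have := (h j h1 h2).2 (m - unitVec n j)
    rw [tsub_add_cancel_of_le (unitVec_le hm)] at this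
    congr 1
    rw [this]
    have := (h j h1 h2).1
    field_simp

variable [Algebra ℂ K]

/-- Every e_r and f_r is a scalar times a product of `cre` and `ann`, so their relations can be
checked in the oscillator algebra. -/
lemma opE_zero (s x : K) : opE n s x 0 = x • cre K n 1 := by
  refine fock_ext fun m => ?_
  simp [opE]

lemma opF_zero (s x : K) : opF n s x 0 = (imI K * kappa s * x⁻¹) • ann n s 1 := by
  refine fock_ext fun m => ?_
  simp [opF, smul_smul]
  ring_nf

lemma opE_last (hn : 1 ≤ n) (s x : K) : opE n s x n = (imI K * kappa s) • ann n s n := by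
  refine fock_ext fun m => ?_
  simp [opE, show n ≠ 0 by omega, smul_smul]

lemma opF_last (hn : 1 ≤ n) (s x : K) : opF n s x n = cre K n n := by
  refine fock_ext fun m => ?_
  simp [opF, show n ≠ 0 by omega]

lemma opE_mid (s x : K) {r : ℕ} (h1 : 1 ≤ r) (h2 : r < n) :
    opE n s x r = cre K n (r + 1) * ann n s r := by
  refine fock_ext fun m => ?_
  simp [opE, show r ≠ 0 by omega, h2.ne]

lemma opF_mid (s x : K) {r : ℕ} (h1 : 1 ≤ r) (h2 : r < n) :
    opF n s x r = cre K n r * ann n s (r + 1) := by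
  refine fock_ext fun m => ?_
  simp only [opF, show r ≠ 0 by omega, h2.ne, if_false, ketOp_ket, Module.End.mul_apply, ann_ket,
    map_smul, cre_ket]
  by_cases h : site m (r + 1) = 0
  · simp [h]
  · rw [tsub_add_eq_add_tsub (unitVec_le h)]

lemma opE_param (s x x' : K) {r : ℕ} (h1 : 1 ≤ r) : opE n s x r = opE n s x' r := by
  simp [opE, show r ≠ 0 by omega]

lemma opF_param (s x x' : K) {r : ℕ} (h1 : 1 ≤ r) : opF n s x r = opF n s x' r := by
  simp [opF, show r ≠ 0 by omega]

lemma opK_eq (s : K) (r : ℕ) : opK n s r = dg (kVal n s r) := rfl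

lemma opKinv_eq (s : K) (r : ℕ) : opKinv n s r = dg fun m => (kVal n s r m)⁻¹ := rfl

lemma kVal_ne_zero {s : K} (hs : s ≠ 0) (r : ℕ) (m : Fin n → ℕ) : kVal n s r m ≠ 0 := by
  have := imI_ne_zero (K := K)
  unfold kVal
  split_ifs
  · exact neg_ne_zero.mpr (mul_ne_zero this (pow_ne_zero _ hs))
  · exact mul_ne_zero this (inv_ne_zero (pow_ne_zero _ hs))
  · exact zpow_ne_zero _ (pow_ne_zero _ hs)

/-- The exponent of `q` by which the eigenvalue of `k_r` changes when a particle is added at the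
site `j`. -/
def kExp (r j : ℕ) : ℤ :=
  if r = 0 then (if j = 1 then 1 else 0)
  else (if j = r + 1 then 1 else 0) - (if j = r then 1 else 0)

/-- One exponent `kExp` serves all r: for r = n the term at site n + 1 never occurs, because j ≤ n.
-/
lemma kVal_shift (hn : 1 ≤ n) {s : K} (hs : s ≠ 0) {r : ℕ} :
    HasShift (kVal n s r) fun j => (s ^ 2) ^ kExp r j := by
  intro j h1 h2
  have hq : s ^ 2 ≠ 0 := pow_ne_zero _ hs
  refine ⟨zpow_ne_zero _ hq, fun m => ?_⟩
  unfold kVal kExp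
  simp only [site_add, site_unitVec]
  split_ifs <;> first | omega | skip
  all_goals
    simp only [zpow_one, zpow_zero, sub_zero, zero_sub, sub_self, one_mul, add_zero, zpow_neg,
      Nat.cast_add, Nat.cast_one]
  · ring
  · field_simp
    ring
  · rw [show ∀ a b : ℤ, -(a + 1) + b = -1 + (-a + b) by intros; ring, zpow_add₀ hq, zpow_neg_one]
  · rw [show ∀ a b : ℤ, -a + (b + 1) = 1 + (-a + b) by intros; ring, zpow_add₀ hq, zpow_one]

end single

/-! ### Commutation relations of the generators on one Fock space -/

section coproduct

variable {n : ℕ}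

/-- The factor by which a diagonal operator with shifts `t` commutes with `f_i`. -/
def shiftF (n : ℕ) (t : ℕ → K) (i : ℕ) : K := if i = n then t n else t i * (t (i + 1))⁻¹

section shift

variable [Algebra ℂ K]

lemma HasShift.dg_mul_opF {χ : (Fin n → ℕ) → K} {t : ℕ → K} (h : HasShift χ t) (s x : K) {i : ℕ}
    (h1 : 1 ≤ i) (h2 : i ≤ n) :
    dg χ * opF n s x i = shiftF n t i • (opF n s x i * dg χ) := by
  unfold shiftF
  split_ifs with hi
  · subst hi
    rw [opF_last h1, h.dg_mul_cre h1 le_rfl]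
  · rw [opF_mid s x h1 (by omega), ← mul_assoc, h.dg_mul_cre h1 h2, smul_mul_assoc, mul_assoc,
      h.dg_mul_ann s (by omega) (by omega), mul_smul_comm, smul_smul, mul_assoc]

lemma HasShift.dg_mul_opE {χ : (Fin n → ℕ) → K} {t : ℕ → K} (h : HasShift χ t) (s x : K) {i : ℕ}
    (h1 : 1 ≤ i) (h2 : i ≤ n) :
    dg χ * opE n s x i = (shiftF n t i)⁻¹ • (opE n s x i * dg χ) := by
  unfold shiftF
  split_ifs with hi
  · subst hi
    rw [opE_last h1, mul_smul_comm, h.dg_mul_ann s h1 le_rfl, smul_mul_assoc, smul_comm]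
  · rw [opE_mid s x h1 (by omega), ← mul_assoc, h.dg_mul_cre (by omega) (by omega),
      smul_mul_assoc, mul_assoc, h.dg_mul_ann s h1 h2, mul_smul_comm, smul_smul, mul_assoc,
      mul_inv, inv_inv, mul_comm (t i)⁻¹]

end shift

lemma dg_comm (χ ψ : (Fin n → ℕ) → K) : dg χ * dg ψ = dg ψ * dg χ := by
  simp only [dg_mul_dg, mul_comm]

lemma dg_mul_dg_inv {χ : (Fin n → ℕ) → K} (h : ∀ m, χ m ≠ 0) :
    dg χ * dg (fun m => (χ m)⁻¹) = 1 := by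
  refine fock_ext fun m => ?_
  simp [smul_smul, h m]

lemma shiftF_zpow {q : K} (hq : q ≠ 0) (e : ℕ → ℤ) (i : ℕ) :
    shiftF n (fun j => q ^ e j) i = q ^ (if i = n then e n else e i - e (i + 1)) := by
  unfold shiftF
  split_ifs
  · rfl
  · rw [zpow_sub₀ hq, div_eq_mul_inv]

/-- The symmetry of the Cartan matrix. -/
lemma shiftF_kExp_symm {q : K} (hq : q ≠ 0) {i j : ℕ} (hi : 1 ≤ i) (hi' : i ≤ n)
    (hj : 1 ≤ j) (hj' : j ≤ n) :
    shiftF n (fun a => q ^ kExp i a) j = shiftF n (fun a => q ^ kExp j a) i := by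
  rw [shiftF_zpow hq, shiftF_zpow hq]
  congr 1
  have hi0 : i ≠ 0 := by omega
  have hj0 : j ≠ 0 := by omega
  have key : ∀ {a b : ℕ}, 1 ≤ a → a < b → b ≤ n →
      (if b = n then kExp a n else kExp a b - kExp a (b + 1)) =
        if a = n then kExp b n else kExp b a - kExp b (a + 1) := by
    intro a b ha hab hb
    simp only [kExp, show a ≠ 0 by omega, show b ≠ 0 by omega, show a ≠ n by omega, if_false,
      show ¬ b = a by omega, show ¬ a = b by omega, show ¬ a = b + 1 by omega,
      show ¬ a + 1 = b + 1 by omega, show ¬ b + 1 = a + 1 by omega, show ¬ b + 1 = a by omega,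
      show ¬ n = a by omega]
    split_ifs <;> omega
  rcases lt_trichotomy i j with h | rfl | h
  · exact key hi h hj'
  · rfl
  · exact (key hj h hi').symm

variable [Algebra ℂ K]

/-- Only creation and annihilation at the same site fail to commute; here the sites to compare are i
with j and i + 1 with j + 1, which differ. -/
lemma commute_opE_opF (s x x' : K) {i j : ℕ} (hij : i ≠ j) (hi : 1 ≤ i)
    (hi' : i ≤ n) (hj : 1 ≤ j) (hj' : j ≤ n) : Commute (opE n s x i) (opF n s x' j) := by
  rcases eq_or_lt_of_le hi' with rfl | hi'
  · rw [opE_last hi, opF_mid s x' hj (by omega)]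
    exact ((ann_cre_comm s hij).mul_right (ann_comm s _ _)).smul_left _
  rcases eq_or_lt_of_le hj' with rfl | hj'
  · rw [opE_mid s x hi hi', opF_last hj]
    exact (cre_comm _ _).mul_left (ann_cre_comm s hij)
  · rw [opE_mid s x hi hi', opF_mid s x' hj hj']
    exact ((cre_comm _ _).mul_right (ann_cre_comm s (by omega)).symm).mul_left
      ((ann_cre_comm s hij).mul_right (ann_comm s _ _))

/-- The coefficient in `[e_r, f_r] = c (k_r - k_r⁻¹)`. -/
def efCoeff (n : ℕ) (s : K) (r : ℕ) : K :=
  if r = n then kappa s * (s + s⁻¹)⁻¹ else (s ^ 2 - (s ^ 2)⁻¹)⁻¹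

/-- For r = n this is [m + 1] − [m] = (q^{m+1/2} + q^{-m-1/2}) / (q^{1/2} + q^{-1/2}). For r < n it
is [b][a + 1] − [a][b + 1] = [b − a]. -/
lemma opE_opF_self (hn : 1 ≤ n) {s : K} (hs : s ≠ 0) (hgen : ∀ k : ℕ, 0 < k → s ^ k ≠ 1)
    (x x' : K) {r : ℕ} (h1 : 1 ≤ r) (h2 : r ≤ n) :
    opE n s x r * opF n s x' r = opF n s x' r * opE n s x r +
      efCoeff n s r • (opK n s r - opKinv n s r) := by
  have hq := sq_sub_inv_ne_zero hs hgen
  have hq1 := sq_sub_one_ne_zero hgen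
  have hq2 := sq_add_one_ne_zero hgen
  have hq4 : s ^ 4 - 1 ≠ 0 := sub_ne_zero.mpr (hgen 4 (by norm_num))
  have hI2 := imI_sq (K := K)
  rw [opK_eq, opKinv_eq]
  rcases eq_or_lt_of_le h2 with rfl | h2
  · rw [opE_last h1, opF_last h1, mul_smul_comm, smul_mul_assoc, ann_mul_cre s h1 le_rfl,
      cre_mul_ann]
    refine fock_ext fun m => ?_
    simp only [LinearMap.smul_apply, LinearMap.add_apply, LinearMap.sub_apply, dg_ket, ← sub_smul,
      smul_smul, ← add_smul]
    congr 1
    simp only [efCoeff, if_true, kVal, show r ≠ 0 by omega, if_false, qInt,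
      pow_succ _ (site _ _), pow_succ _ (2 * _), pow_mul, kappa, mul_inv, inv_inv]
    have hI3 : (imI K)⁻¹ = - imI K := by
      rw [inv_eq_of_mul_eq_one_left]
      linear_combination - hI2
    rw [hI3]
    have : ((s ^ 2) ^ site m r) ≠ 0 := pow_ne_zero _ (pow_ne_zero _ hs)
    generalize (s ^ 2) ^ site m r = Q at *
    field_simp
    ring_nf
  · rw [opE_mid s x h1 h2, opF_mid s x' h1 h2]
    have e1 : cre K n (r + 1) * ann n s r * (cre K n r * ann n s (r + 1)) =
        (dg fun m => qInt s (site m (r + 1))) * (dg fun m => qInt s (site m r + 1)) := by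
      rw [← ann_mul_cre s h1 h2.le, ← cre_mul_ann]
      rw [mul_assoc, mul_assoc]
      congr 1
      rw [← mul_assoc, ← mul_assoc, mul_assoc (ann n s (r + 1)),
        ((ann_comm s r (r + 1)).mul_left (ann_cre_comm s (by omega)).symm).eq]
    have e2 : cre K n r * ann n s (r + 1) * (cre K n (r + 1) * ann n s r) =
        (dg fun m => qInt s (site m r)) * (dg fun m => qInt s (site m (r + 1) + 1)) := by
      rw [← ann_mul_cre s (by omega) h2, ← cre_mul_ann]
      rw [mul_assoc, mul_assoc]
      congr 1
      rw [← mul_assoc, ((ann_comm s r (r + 1)).mul_right (ann_cre_comm s (by omega))).eq]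
    rw [e1, e2, dg_mul_dg, dg_mul_dg]
    refine fock_ext fun m => ?_
    simp only [LinearMap.smul_apply, LinearMap.add_apply, LinearMap.sub_apply, dg_ket, ← sub_smul,
      smul_smul, ← add_smul]
    congr 1
    simp only [efCoeff, kVal, show r ≠ 0 by omega, h2.ne, if_false, qInt, pow_succ _ (site _ _),
      zpow_add₀ (pow_ne_zero 2 hs), zpow_neg, zpow_natCast]
    have h1 : ((s ^ 2) ^ site m r) ≠ 0 := pow_ne_zero _ (pow_ne_zero _ hs)
    have h2 : ((s ^ 2) ^ site m (r + 1)) ≠ 0 := pow_ne_zero _ (pow_ne_zero _ hs)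
    generalize (s ^ 2) ^ site m r = Q at *
    generalize (s ^ 2) ^ site m (r + 1) = Q' at *
    field_simp
    ring

end coproduct

/-! ### Commutation relations of the coproducts -/

section tensor

variable {n : ℕ}

/-- The diagonal operator with eigenvalues `χ 𝐦 χ 𝐦'` on `|𝐦⟩ ⊗ |𝐦'⟩`. -/
def dg₂ (χ : (Fin n → ℕ) → K) : Module.End K (Fock K n ⊗[K] Fock K n) :=
  TensorProduct.map (dg χ) (dg χ)

lemma dg₂_ket (χ : (Fin n → ℕ) → K) (m m' : Fin n → ℕ) :
    dg₂ χ (ket K m ⊗ₜ ket K m') = (χ m * χ m') • (ket K m ⊗ₜ[K] ket K m') := by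
  simp [dg₂, TensorProduct.smul_tmul', smul_smul, mul_comm]

lemma map_mul_map (f g f' g' : Module.End K (Fock K n)) :
    (TensorProduct.map f g * TensorProduct.map f' g' :
      Module.End K (Fock K n ⊗[K] Fock K n)) = TensorProduct.map (f * f') (g * g') :=
  (TensorProduct.map_mul f f' g g').symm

/-- The cross terms e k' ⊗ k f and k' e ⊗ f k agree because the same scalar c occurs in both
hypotheses. For e_i, f_j, k_i, k_j⁻¹ this is the symmetry of the Cartan matrix. -/
lemma coproduct_commutator {e f k k' d : Module.End K (Fock K n)} {c : K}
    (hkf : k * f = c • (f * k)) (hke : k' * e = c • (e * k')) (h1 : e * f = f * e + d) :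
    (TensorProduct.map 1 e + TensorProduct.map e k : Module.End K (Fock K n ⊗[K] Fock K n)) *
        (TensorProduct.map f 1 + TensorProduct.map k' f) =
      (TensorProduct.map f 1 + TensorProduct.map k' f) *
          (TensorProduct.map 1 e + TensorProduct.map e k) +
        (TensorProduct.map k' d + TensorProduct.map d k) := by
  have h2 : TensorProduct.map (k' * e) (f * k) = TensorProduct.map (e * k') (k * f) := by
    rw [hkf, hke, TensorProduct.map_smul_left, TensorProduct.map_smul_right]
  simp only [mul_add, add_mul, map_mul_map, one_mul, mul_one, h2, h1, TensorProduct.map_add_right,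
    TensorProduct.map_add_left]
  abel

variable [Algebra ℂ K]

/-- The action of `Δ e_r = 1 ⊗ e_r + e_r ⊗ k_r`, where the two factors have the spectral
parameters `x` and `y`. -/
def copE (n : ℕ) (s x y : K) (r : ℕ) : Module.End K (Fock K n ⊗[K] Fock K n) :=
  TensorProduct.map LinearMap.id (opE n s y r) + TensorProduct.map (opE n s x r) (opK n s r)

/-- The action of `Δ f_r = f_r ⊗ 1 + k_r⁻¹ ⊗ f_r`, where the two factors have the spectral
parameters `x` and `y`. -/
def copF (n : ℕ) (s x y : K) (r : ℕ) : Module.End K (Fock K n ⊗[K] Fock K n) :=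
  TensorProduct.map (opF n s x r) LinearMap.id + TensorProduct.map (opKinv n s r) (opF n s y r)

lemma copE_param (s x y : K) {r : ℕ} (h1 : 1 ≤ r) : copE n s x y r = copE n s 1 1 r := by
  rw [copE, opE_param s x 1 h1, opE_param s y 1 h1, copE]

lemma copF_param (s x y : K) {r : ℕ} (h1 : 1 ≤ r) : copF n s x y r = coprodF n s r := by
  rw [copF, opF_param s x 1 h1, opF_param s y 1 h1, coprodF]

lemma map_opK (s : K) (r : ℕ) :
    TensorProduct.map (opK n s r) (opK n s r) = dg₂ (kVal n s r) := rfl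

lemma HasShift.dg₂_mul_coprodF {χ : (Fin n → ℕ) → K} {t : ℕ → K} (h : HasShift χ t) (s : K)
    {i : ℕ} (h1 : 1 ≤ i) (h2 : i ≤ n) :
    dg₂ χ * coprodF n s i = shiftF n t i • (coprodF n s i * dg₂ χ) := by
  rw [coprodF, dg₂, mul_add, add_mul, map_mul_map, map_mul_map, map_mul_map, map_mul_map,
    h.dg_mul_opF s 1 h1 h2, opKinv_eq, dg_comm χ, TensorProduct.map_smul_left,
    TensorProduct.map_smul_right, smul_add]
  rfl

lemma opKinv_mul_opE (hn : 1 ≤ n) {s : K} (hs : s ≠ 0) (x : K) {i j : ℕ} (hi : 1 ≤ i)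
    (hi' : i ≤ n) :
    opKinv n s j * opE n s x i =
      shiftF n (fun a => (s ^ 2) ^ kExp j a) i • (opE n s x i * opKinv n s j) := by
  have h := (kVal_shift hn hs (r := j)).inv.dg_mul_opE s x hi hi'
  rw [opKinv_eq, h]
  congr 1
  unfold shiftF
  split_ifs <;> simp [mul_comm]

lemma copE_mul_coprodF (hn : 1 ≤ n) {s : K} (hs : s ≠ 0) {i j : ℕ}
    (hi : 1 ≤ i) (hi' : i ≤ n) (hj : 1 ≤ j) (hj' : j ≤ n) {d : Module.End K (Fock K n)}
    (hd : opE n s 1 i * opF n s 1 j = opF n s 1 j * opE n s 1 i + d) :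
    copE n s 1 1 i * coprodF n s j = coprodF n s j * copE n s 1 1 i +
      (TensorProduct.map (opKinv n s j) d + TensorProduct.map d (opK n s i)) := by
  refine coproduct_commutator ((kVal_shift hn hs (r := i)).dg_mul_opF s 1 hj hj') ?_ hd
  rw [shiftF_kExp_symm (pow_ne_zero 2 hs) hi hi' hj hj']
  exact opKinv_mul_opE hn hs 1 hi hi'

lemma commute_copE_coprodF (hn : 1 ≤ n) {s : K} (hs : s ≠ 0) {i j : ℕ} (hij : i ≠ j)
    (hi : 1 ≤ i) (hi' : i ≤ n) (hj : 1 ≤ j) (hj' : j ≤ n) :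
    copE n s 1 1 i * coprodF n s j = coprodF n s j * copE n s 1 1 i := by
  rw [copE_mul_coprodF hn hs hi hi' hj hj' (d := 0), TensorProduct.map_zero_left,
    TensorProduct.map_zero_right, add_zero, add_zero]
  rw [(commute_opE_opF s 1 1 hij hi hi' hj hj').eq, add_zero]

/-- The mixed terms k_r⁻¹ ⊗ k_r cancel in k_r⁻¹ ⊗ (k_r − k_r⁻¹) + (k_r − k_r⁻¹) ⊗ k_r. -/
lemma copE_coprodF_self (hn : 1 ≤ n) {s : K} (hs : s ≠ 0) (hgen : ∀ k : ℕ, 0 < k → s ^ k ≠ 1)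
    {r : ℕ} (h1 : 1 ≤ r) (h2 : r ≤ n) :
    copE n s 1 1 r * coprodF n s r = coprodF n s r * copE n s 1 1 r +
      (efCoeff n s r • dg₂ (kVal n s r) + (-efCoeff n s r) • dg₂ fun m => (kVal n s r m)⁻¹) := by
  rw [copE_mul_coprodF hn hs h1 h2 h1 h2 (opE_opF_self hn hs hgen 1 1 h1 h2)]
  congr 1
  refine tensor_ext fun m m' => ?_
  simp only [LinearMap.add_apply, LinearMap.smul_apply, dg₂_ket, TensorProduct.map_tmul, opK_eq,
    opKinv_eq, LinearMap.sub_apply, dg_ket, ← sub_smul, ← TensorProduct.smul_tmul',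
    TensorProduct.tmul_smul, smul_smul, ← add_smul]
  congr 1
  ring

end tensor

/-! ### Singular vectors -/

section singular

variable {n : ℕ}

lemma HasShift.apply_smul {χ : (Fin n → ℕ) → K} {t : ℕ → K} (h : HasShift χ t) {j : ℕ}
    (h1 : 1 ≤ j) (h2 : j ≤ n) (a : ℕ) : χ (a • unitVec n j) = t j ^ a * χ 0 := by
  induction a with
  | zero => simp
  | succ a ih => rw [add_smul, one_smul, (h j h1 h2).2, ih, pow_succ]; ring

variable [Algebra ℂ K]

/-- The basis vector `|a 𝐞ₙ⟩ ⊗ |b 𝐞ₙ⟩`. -/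
def kk (K : Type*) [Field K] (n a b : ℕ) : Fock K n ⊗[K] Fock K n :=
  ket K (a • unitVec n n) ⊗ₜ ket K (b • unitVec n n)

/-- The coefficients of the normalized singular vectors. -/
def singCoeff (s : K) (p : ℕ × ℕ) : K :=
  imI K ^ p.1 * s ^ (p.1 ^ 2 + 2 * p.1 * p.2) / (qFactorial s p.1 * qFactorial s p.2)

lemma singCoeff_succ_left {s : K} (hs : s ≠ 0) (hgen : ∀ k : ℕ, 0 < k → s ^ k ≠ 1) (a b : ℕ) :
    qInt s (a + 1) * singCoeff s (a + 1, b) =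
      imI K * s ^ (2 * a + 2 * b + 1) * singCoeff s (a, b) := by
  have h1 := qFactorial_ne_zero hs hgen a
  have h2 := qFactorial_ne_zero hs hgen b
  have h3 := qInt_ne_zero hs hgen (Nat.succ_pos a)
  simp only [singCoeff, qFactorial_succ]
  field_simp
  ring

lemma singCoeff_succ_right {s : K} (hs : s ≠ 0) (hgen : ∀ k : ℕ, 0 < k → s ^ k ≠ 1) (a b : ℕ) :
    qInt s (b + 1) * singCoeff s (a, b + 1) = s ^ (2 * a) * singCoeff s (a, b) := by
  have h1 := qFactorial_ne_zero hs hgen a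
  have h2 := qFactorial_ne_zero hs hgen b
  have h3 := qInt_ne_zero hs hgen (Nat.succ_pos b)
  simp only [singCoeff, qFactorial_succ]
  field_simp
  ring

/-- The singular vector `v_l / [l]!`. -/
def vhat (n : ℕ) (s : K) (l : ℕ) : Fock K n ⊗[K] Fock K n :=
  ∑ p ∈ Finset.HasAntidiagonal.antidiagonal l, singCoeff s p • kk K n p.1 p.2

lemma singularVec_eq (s : K) (l : ℕ) :
    singularVec n s l = qFactorial s l • vhat n s l := by
  rw [vhat, Finset.Nat.sum_antidiagonal_eq_sum_range_succ_mk, Finset.smul_sum, singularVec]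
  refine Finset.sum_congr rfl fun k hk => ?_
  have hk : k ≤ l := by simpa [Nat.lt_succ_iff] using hk
  rw [smul_smul, kk]
  congr 1
  simp only [qBinom, hk, if_true, singCoeff]
  have : (2 * (l : ℤ) * k - (k : ℤ) ^ 2) = ((k ^ 2 + 2 * k * (l - k) : ℕ) : ℤ) := by
    push_cast [hk]
    ring
  rw [this, zpow_natCast]
  ring

lemma HasShift.dg₂_vhat {χ : (Fin n → ℕ) → K} {t : ℕ → K} (h : HasShift χ t) (hn : 1 ≤ n)
    (s : K) (l : ℕ) : dg₂ χ (vhat n s l) = (t n ^ l * χ 0 ^ 2) • vhat n s l := by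
  rw [vhat, map_sum, Finset.smul_sum]
  refine Finset.sum_congr rfl fun p hp => ?_
  rw [map_smul, kk, dg₂_ket, h.apply_smul hn le_rfl, h.apply_smul hn le_rfl, smul_comm,
    ← Finset.HasAntidiagonal.mem_antidiagonal.mp hp, pow_add]
  ring_nf

lemma copE_last_kk (hn : 1 ≤ n) (s : K) (a b : ℕ) :
    copE n s 1 1 n (kk K n a b) = (imI K * kappa s) • (qInt s b • kk K n a (b - 1) +
      (qInt s a * (imI K * (s ^ (2 * b + 1))⁻¹)) • kk K n (a - 1) b) := by
  have h : ∀ a : ℕ, a • unitVec n n - unitVec n n = (a - 1) • unitVec n n := fun a => by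
    rcases a with - | a
    · simp
    · rw [add_smul, one_smul, add_tsub_cancel_right, Nat.add_sub_cancel]
  simp [copE, kk, opE_last hn, -nsmul_eq_mul, h, opK_eq, kVal, show n ≠ 0 by omega,
    site_unitVec_self hn le_rfl, TensorProduct.smul_tmul', smul_smul]
  ring_nf

/-- For r < n there is no particle at site r to annihilate. For r = n the two recurrences of
`singCoeff` make every coefficient a multiple of 1 + i². -/
lemma copE_vhat (hn : 1 ≤ n) {s : K} (hs : s ≠ 0) (hgen : ∀ k : ℕ, 0 < k → s ^ k ≠ 1)
    {r : ℕ} (h1 : 1 ≤ r) (h2 : r ≤ n) (l : ℕ) : copE n s 1 1 r (vhat n s l) = 0 := by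
  rcases eq_or_lt_of_le h2 with rfl | h2
  · rw [vhat, map_sum]
    simp only [map_smul, copE_last_kk hn, smul_comm _ (imI K * kappa s), ← Finset.smul_sum,
      smul_add, Finset.sum_add_distrib]
    rcases l with - | l
    · simp
    rw [Finset.Nat.sum_antidiagonal_succ', Finset.Nat.sum_antidiagonal_succ]
    simp only [qInt_zero, zero_smul, smul_zero, zero_mul, zero_add, Nat.add_sub_cancel, smul_smul,
      ← smul_add, ← Finset.sum_add_distrib, ← add_smul]
    rw [Finset.sum_eq_zero, smul_zero]
    intro p _
    rw [← mul_assoc, mul_comm _ (qInt s _), singCoeff_succ_right hs hgen, mul_comm _ (qInt s _),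
      singCoeff_succ_left hs hgen]
    convert zero_smul K _
    have := imI_sq (K := K)
    have h : s ^ (2 * p.1 + 2 * p.2 + 1) * (s ^ (2 * p.2 + 1))⁻¹ = s ^ (2 * p.1) := by
      rw [add_assoc, pow_add, mul_inv_cancel_right₀ (pow_ne_zero _ hs)]
    linear_combination singCoeff s p * imI K ^ 2 * h + singCoeff s p * s ^ (2 * p.1) * this
  · rw [vhat, map_sum]
    refine Finset.sum_eq_zero fun p _ => ?_
    simp [copE, kk, opE_mid s _ h1 h2, site_unitVec_ne h2.ne, -nsmul_eq_mul]

end singular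

/-! ### The components -/

section components

variable {n : ℕ} [Algebra ℂ K]

lemma singularVec_mem (s : K) (l : ℕ) : singularVec n s l ∈ component n s l :=
  Submodule.mem_sInf.mpr fun _ hW => hW.1

lemma vhat_mem {s : K} (hs : s ≠ 0) (hgen : ∀ k : ℕ, 0 < k → s ^ k ≠ 1) (l : ℕ) :
    vhat n s l ∈ component n s l := by
  have := singularVec_mem (n := n) s l
  rw [singularVec_eq] at this
  exact (Submodule.smul_mem_iff _ (qFactorial_ne_zero hs hgen l)).mp this

lemma coprodF_mem {s : K} {l r : ℕ} (h1 : 1 ≤ r) (h2 : r ≤ n) {w : Fock K n ⊗[K] Fock K n}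
    (hw : w ∈ component n s l) : coprodF n s r w ∈ component n s l :=
  Submodule.mem_sInf.mpr fun W hW => hW.2 r h1 h2 w (Submodule.mem_sInf.mp hw W hW)

/-- Induction over V_l. Intersecting W with V_l makes membership in V_l available in the induction
step. -/
lemma component_le {s : K} {l : ℕ} {W : Submodule K (Fock K n ⊗[K] Fock K n)}
    (hv : singularVec n s l ∈ W)
    (hF : ∀ r, 1 ≤ r → r ≤ n → ∀ w ∈ component n s l, w ∈ W → coprodF n s r w ∈ W) :
    component n s l ≤ W := by
  have : component n s l ≤ W ⊓ component n s l :=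
    sInf_le ⟨⟨hv, singularVec_mem s l⟩, fun r h1 h2 w hw =>
      ⟨hF r h1 h2 w hw.2 hw.1, coprodF_mem h1 h2 hw.2⟩⟩
  exact this.trans inf_le_left

lemma HasShift.dg₂_mem {χ : (Fin n → ℕ) → K} {t : ℕ → K} (h : HasShift χ t) (hn : 1 ≤ n) {s : K}
    {l : ℕ} {w : Fock K n ⊗[K] Fock K n} (hw : w ∈ component n s l) :
    dg₂ χ w ∈ component n s l := by
  refine component_le (W := (component n s l).comap (dg₂ χ)) ?_ ?_ hw
  · rw [Submodule.mem_comap, singularVec_eq, map_smul, h.dg₂_vhat hn, smul_comm,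
      ← singularVec_eq]
    exact Submodule.smul_mem _ _ (singularVec_mem s l)
  · intro r h1 h2 w _ hw
    have := LinearMap.congr_fun (h.dg₂_mul_coprodF s h1 h2) w
    rw [Module.End.mul_apply, LinearMap.smul_apply, Module.End.mul_apply] at this
    rw [Submodule.mem_comap, this]
    exact Submodule.smul_mem _ _ (coprodF_mem h1 h2 hw)

/-- The highest weight argument: e_r kills v_l, and moving it past f_i costs at most a combination
of k_r and k_r⁻¹, which preserve V_l. -/
lemma copE_mem (hn : 1 ≤ n) {s : K} (hs : s ≠ 0) (hgen : ∀ k : ℕ, 0 < k → s ^ k ≠ 1)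
    {l r : ℕ} (h1 : 1 ≤ r) (h2 : r ≤ n) {w : Fock K n ⊗[K] Fock K n}
    (hw : w ∈ component n s l) : copE n s 1 1 r w ∈ component n s l := by
  refine component_le (W := (component n s l).comap (copE n s 1 1 r)) ?_ ?_ hw
  · rw [Submodule.mem_comap, singularVec_eq, map_smul, copE_vhat hn hs hgen h1 h2, smul_zero]
    exact Submodule.zero_mem _
  · intro i hi hi' w hw' hw
    rw [Submodule.mem_comap, ← Module.End.mul_apply]
    rcases eq_or_ne r i with rfl | hri
    · rw [copE_coprodF_self hn hs hgen hi hi']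
      refine Submodule.add_mem _ (coprodF_mem hi hi' hw) (Submodule.add_mem _
        (Submodule.smul_mem _ _ ((kVal_shift hn hs).dg₂_mem hn hw'))
        (Submodule.smul_mem _ _ ((kVal_shift hn hs).inv.dg₂_mem hn hw')))
    · rw [commute_copE_coprodF hn hs hri h1 h2 hi hi']
      exact coprodF_mem hi hi' hw

end components

/-! ### Creation in one tensor factor -/

section creation

variable {n : ℕ}

/-- Creation at the site `j` of the right factor. -/
def creR (K : Type*) [Field K] (n j : ℕ) : Module.End K (Fock K n ⊗[K] Fock K n) :=
  TensorProduct.map LinearMap.id (cre K n j)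

variable [Algebra ℂ K]

/-- The eigenvalue `-i q ^ (m_j + 1/2)`. -/
def siteVal (n : ℕ) (s : K) (j : ℕ) (m : Fin n → ℕ) : K := -(imI K * s ^ (2 * site m j + 1))

lemma siteVal_shift {s : K} (hs : s ≠ 0) (j : ℕ) :
    HasShift (siteVal n s j) fun a => (s ^ 2) ^ (if a = j then 1 else 0 : ℤ) := by
  intro a h1 h2
  refine ⟨zpow_ne_zero _ (pow_ne_zero _ hs), fun m => ?_⟩
  simp only [siteVal, site_add, site_unitVec]
  split_ifs <;> first | omega | skip
  · rw [zpow_one]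
    ring
  · simp

/-- Creation at the site `j` of the left factor, with the twist in `Δ e_0`. -/
def creL (n : ℕ) (s : K) (j : ℕ) : Module.End K (Fock K n ⊗[K] Fock K n) :=
  TensorProduct.map (cre K n j) (dg (siteVal n s j))

lemma copE_zero (s x y : K) : copE n s x y 0 = y • creR K n 1 + x • creL n s 1 := by
  rw [copE, opE_zero, opE_zero, TensorProduct.map_smul_right, TensorProduct.map_smul_left]
  rfl

lemma cre_commute_opF (s x : K) {j r : ℕ} (hj : 1 ≤ j) (hr : j ≤ r) (hr' : r ≤ n) :
    Commute (cre K n j) (opF n s x r) := by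
  rcases eq_or_lt_of_le hr' with rfl | hr'
  · rw [opF_last (by omega)]
    exact cre_comm _ _
  · rw [opF_mid s x (by omega) hr']
    exact (cre_comm _ _).mul_right (ann_cre_comm s (by omega)).symm

lemma creR_comm_coprodF {s : K} {j r : ℕ} (hj : 1 ≤ j) (hr : j ≤ r)
    (hr' : r ≤ n) : creR K n j * coprodF n s r = coprodF n s r * creR K n j := by
  have h := (cre_commute_opF s 1 hj hr hr').eq
  change TensorProduct.map 1 _ * (TensorProduct.map _ 1 + _) =
    (TensorProduct.map _ 1 + _) * TensorProduct.map 1 _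
  simp only [mul_add, add_mul, map_mul_map, one_mul, mul_one, h]

/-- The twist `siteVal` makes this work: moving it past f_r produces the same power of q as moving
k_r⁻¹ past creation at site j. -/
lemma creL_comm_coprodF (hn : 1 ≤ n) {s : K} (hs : s ≠ 0) {j r : ℕ} (hj : 1 ≤ j) (hr : j ≤ r)
    (hr' : r ≤ n) : creL n s j * coprodF n s r = coprodF n s r * creL n s j := by
  have h := (cre_commute_opF s 1 hj hr hr').eq
  have hq : s ^ 2 ≠ 0 := pow_ne_zero _ hs
  have h1 := (siteVal_shift (n := n) hs j).dg_mul_opF s 1 (hj.trans hr) hr'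
  have h2 := (kVal_shift hn hs (r := r)).inv.dg_mul_cre hj (hr.trans hr')
  have h3 : shiftF n (fun a => (s ^ 2) ^ (if a = j then 1 else 0 : ℤ)) r =
      ((s ^ 2) ^ kExp r j)⁻¹ := by
    rw [shiftF_zpow hq, ← zpow_neg]
    congr 1
    unfold kExp
    split_ifs <;> omega
  change TensorProduct.map _ _ * (TensorProduct.map _ 1 + _) =
    (TensorProduct.map _ 1 + _) * TensorProduct.map _ _
  simp only [mul_add, add_mul, map_mul_map, one_mul, mul_one, h, h1, opKinv_eq, h2, h3,
    TensorProduct.map_smul_left, TensorProduct.map_smul_right]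

end creation

/-! ### Creation operators on singular vectors -/

section sums

lemma qInt_add {s : K} (hs : s ≠ 0) (a b : ℕ) :
    qInt s (a + b) = (s ^ 2) ^ b * qInt s a + ((s ^ 2) ^ a)⁻¹ * qInt s b := by
  have h1 : (s ^ 2) ^ a ≠ 0 := pow_ne_zero _ (pow_ne_zero _ hs)
  have h2 : (s ^ 2) ^ b ≠ 0 := pow_ne_zero _ (pow_ne_zero _ hs)
  simp only [qInt, pow_add, ← mul_div_assoc, ← add_div]
  congr 1
  generalize (s ^ 2) ^ a = Q at *
  generalize (s ^ 2) ^ b = Q' at *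
  field_simp
  ring

lemma qInt_add' {s : K} (hs : s ≠ 0) (a b : ℕ) :
    qInt s (a + b) = ((s ^ 2) ^ b)⁻¹ * qInt s a + (s ^ 2) ^ a * qInt s b := by
  rw [add_comm a b, qInt_add hs, add_comm]

/-- Reindexing by (a, b) ↦ (a + 1, b − 1); the boundary terms vanish by `hg` and `hh`. -/
lemma sum_antidiagonal_shift {M : Type*} [AddCommMonoid M] [Module K M] (l : ℕ)
    (X : ℕ → ℕ → M) (g h : ℕ × ℕ → K) (hg : ∀ a, g (a, 0) = 0) (hh : ∀ b, h (0, b) = 0)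
    (hgh : ∀ a b, h (a + 1, b) = g (a, b + 1)) :
    ∑ p ∈ Finset.HasAntidiagonal.antidiagonal l, g p • X (p.1 + 1) (p.2 - 1) =
      ∑ p ∈ Finset.HasAntidiagonal.antidiagonal l, h p • X p.1 p.2 := by
  rcases l with - | l
  · simp [hg, hh]
  · rw [Finset.Nat.sum_antidiagonal_succ', Finset.Nat.sum_antidiagonal_succ]
    simp [hg, hh, hgh]

lemma sum_antidiagonal_shift' {M : Type*} [AddCommMonoid M] [Module K M] (l : ℕ)
    (X : ℕ → ℕ → M) (g h : ℕ × ℕ → K) (hg : ∀ b, g (0, b) = 0) (hh : ∀ a, h (a, 0) = 0)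
    (hgh : ∀ a b, h (a, b + 1) = g (a + 1, b)) :
    ∑ p ∈ Finset.HasAntidiagonal.antidiagonal l, g p • X (p.1 - 1) (p.2 + 1) =
      ∑ p ∈ Finset.HasAntidiagonal.antidiagonal l, h p • X p.1 p.2 := by
  rcases l with - | l
  · simp [hg, hh]
  · rw [Finset.Nat.sum_antidiagonal_succ, Finset.Nat.sum_antidiagonal_succ']
    simp [hg, hh, hgh]

/-- Split a sum over `a + b = l + 1` with summands proportional to
`α [a] + β [b]`. -/
lemma sum_antidiagonal_split {M : Type*} [AddCommMonoid M] [Module K M] (s : K) (l : ℕ)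
    (X : ℕ → ℕ → M) (α β : ℕ × ℕ → K) :
    ∑ p ∈ Finset.HasAntidiagonal.antidiagonal (l + 1),
        (qInt s p.1 * α p + qInt s p.2 * β p) • X p.1 p.2 =
      ∑ p ∈ Finset.HasAntidiagonal.antidiagonal l,
        ((qInt s (p.1 + 1) * α (p.1 + 1, p.2)) • X (p.1 + 1) p.2 +
          (qInt s (p.2 + 1) * β (p.1, p.2 + 1)) • X p.1 (p.2 + 1)) := by
  simp only [add_smul, Finset.sum_add_distrib]
  congr 1
  · rw [Finset.Nat.sum_antidiagonal_succ]
    simp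
  · rw [Finset.Nat.sum_antidiagonal_succ']
    simp

lemma smul_unitVec_sub {n : ℕ} (a : ℕ) : a • unitVec n n - unitVec n n = (a - 1) • unitVec n n := by
  rcases a with - | a
  · simp
  · rw [add_smul, one_smul, add_tsub_cancel_right, Nat.add_sub_cancel]

end sums

section core

variable {n : ℕ}

/-- The vector `|a 𝐞ₙ + 𝐞_j⟩ ⊗ |b 𝐞ₙ⟩`. -/
def kkL (K : Type*) [Field K] (n j a b : ℕ) : Fock K n ⊗[K] Fock K n :=
  ket K (a • unitVec n n + unitVec n j) ⊗ₜ ket K (b • unitVec n n)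

/-- The vector `|a 𝐞ₙ⟩ ⊗ |b 𝐞ₙ + 𝐞_j⟩`. -/
def kkR (K : Type*) [Field K] (n j a b : ℕ) : Fock K n ⊗[K] Fock K n :=
  ket K (a • unitVec n n) ⊗ₜ ket K (b • unitVec n n + unitVec n j)

lemma creR_kk (j a b : ℕ) : creR K n j (kk K n a b) = kkR K n j a b := by
  simp [creR, kk, kkR]

lemma creR_last_kk (a b : ℕ) : creR K n n (kk K n a b) = kk K n a (b + 1) := by
  simp [creR, kk, add_smul, -nsmul_eq_mul]

variable [Algebra ℂ K]

lemma opKinv_last_ket (hn : 1 ≤ n) (s : K) (m : Fin n → ℕ) :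
    opKinv n s n (ket K m) = (-(imI K * s * (s ^ 2) ^ site m n)) • ket K m := by
  have hI3 : (imI K)⁻¹ = - imI K := by
    rw [inv_eq_of_mul_eq_one_left]
    linear_combination - imI_sq (K := K)
  simp only [opKinv_eq, dg_ket, kVal, show n ≠ 0 by omega, if_false, if_true, mul_inv, inv_inv, hI3]
  ring_nf

lemma coprodF_last_ket (hn : 1 ≤ n) (s : K) (m m' : Fin n → ℕ) :
    coprodF n s n (ket K m ⊗ₜ ket K m') = ket K (m + unitVec n n) ⊗ₜ[K] ket K m' +
      (-(imI K * s * (s ^ 2) ^ site m n)) • ket K m ⊗ₜ[K] ket K (m' + unitVec n n) := by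
  simp only [coprodF, LinearMap.add_apply, TensorProduct.map_tmul, LinearMap.id_apply,
    opF_last hn, cre_ket, opKinv_last_ket hn, TensorProduct.smul_tmul']

lemma coprodF_last_kk (hn : 1 ≤ n) (s : K) (a b : ℕ) :
    coprodF n s n (kk K n a b) =
      kk K n (a + 1) b + (-(imI K * s * (s ^ 2) ^ a)) • kk K n a (b + 1) := by
  rw [kk, coprodF_last_ket hn, site_smul, site_unitVec_self hn le_rfl, mul_one]
  simp only [kk, add_smul, one_smul]

lemma coprodF_last_kkL (hn : 1 ≤ n) (s : K) {j : ℕ} (hj : j < n) (a b : ℕ) :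
    coprodF n s n (kkL K n j a b) =
      kkL K n j (a + 1) b + (-(imI K * s * (s ^ 2) ^ a)) • kkL K n j a (b + 1) := by
  rw [kkL, coprodF_last_ket hn, site_add, site_smul, site_unitVec_self hn le_rfl, mul_one,
    site_unitVec_ne hj.ne', add_zero]
  simp only [kkL, add_smul, one_smul, add_right_comm]

lemma coprodF_last_kkR (hn : 1 ≤ n) (s : K) (j a b : ℕ) :
    coprodF n s n (kkR K n j a b) =
      kkR K n j (a + 1) b + (-(imI K * s * (s ^ 2) ^ a)) • kkR K n j a (b + 1) := by
  rw [kkR, coprodF_last_ket hn, site_smul, site_unitVec_self hn le_rfl, mul_one]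
  simp only [kkR, add_smul, one_smul, add_right_comm]

lemma creL_kk (s : K) {j : ℕ} (hj : j < n) (a b : ℕ) :
    creL n s j (kk K n a b) = (-(imI K * s)) • kkL K n j a b := by
  simp [creL, kk, kkL, siteVal, site_unitVec_ne hj.ne, -nsmul_eq_mul, -neg_smul]

lemma creL_last_kk (hn : 1 ≤ n) (s : K) (a b : ℕ) :
    creL n s n (kk K n a b) = (-(imI K * s * (s ^ 2) ^ b)) • kk K n (a + 1) b := by
  simp only [creL, kk, siteVal, site_unitVec_self hn le_rfl, site_smul, add_smul, one_smul, mul_one,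
    TensorProduct.map_tmul, cre_ket, dg_ket, TensorProduct.tmul_smul, pow_succ _ (2 * b), pow_mul]
  ring_nf

/-- The operator `f_{n-d} ⋯ f_{n-1}`. -/
def pathF (n : ℕ) (s : K) : ℕ → Module.End K (Fock K n ⊗[K] Fock K n)
  | 0 => 1
  | d + 1 => coprodF n s (n - (d + 1)) * pathF n s d

lemma coprodF_mid_ket (s : K) {r : ℕ} (h1 : 1 ≤ r) (h2 : r < n) (m m' : Fin n → ℕ) :
    coprodF n s r (ket K m ⊗ₜ ket K m') =
      qInt s (site m (r + 1)) •
          ket K (m - unitVec n (r + 1) + unitVec n r) ⊗ₜ[K] ket K m' +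
        ((kVal n s r m)⁻¹ * qInt s (site m' (r + 1))) •
          ket K m ⊗ₜ[K] ket K (m' - unitVec n (r + 1) + unitVec n r) := by
  simp [coprodF, opF_mid s 1 h1 h2, opKinv_eq, TensorProduct.smul_tmul', smul_smul, mul_comm]

/-- One particle travels from site n to site n − (d + 1). Quantum integers and the twist arise only
when it leaves site n: the later sites hold this particle alone, and [1] = 1. -/
lemma pathF_kk {s : K} (hs : s ≠ 0) (hgen : ∀ k : ℕ, 0 < k → s ^ k ≠ 1) (a b : ℕ) {d : ℕ}
    (hd : d + 1 < n) :
    pathF n s (d + 1) (kk K n a b) = qInt s a • kkL K n (n - (d + 1)) (a - 1) b +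
      (((s ^ 2) ^ a)⁻¹ * qInt s b) • kkR K n (n - (d + 1)) a (b - 1) := by
  induction d with
  | zero =>
    have h : n - (0 + 1) + 1 = n := by omega
    rw [pathF, pathF, mul_one, kk, coprodF_mid_ket s (by omega) (by omega), h, kkL, kkR,
      smul_unitVec_sub, smul_unitVec_sub]
    simp only [site_smul, site_unitVec_self (show 1 ≤ n by omega) le_rfl, mul_one, kVal,
      show n - (0 + 1) ≠ 0 by omega, show n - (0 + 1) ≠ n by omega, if_false, h,
      site_unitVec_ne (show n - (0 + 1) ≠ n by omega), mul_zero, Nat.cast_zero, neg_zero, zero_add,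
      zpow_natCast]
  | succ d ih =>
    obtain ⟨r, hr⟩ : ∃ r, n - (d + 1 + 1) = r := ⟨_, rfl⟩
    have hr1 : n - (d + 1) = r + 1 := by omega
    rw [pathF, Module.End.mul_apply, ih (by omega), hr1, hr, map_add, map_smul, map_smul, kkL, kkR,
      coprodF_mid_ket s (by omega) (by omega), coprodF_mid_ket s (by omega) (by omega)]
    have e : ∀ m : Fin n → ℕ, m + unitVec n (r + 1) - unitVec n (r + 1) = m :=
      fun m => add_tsub_cancel_right _ _
    simp [site_unitVec_ne (show r + 1 ≠ n by omega), -nsmul_eq_mul, kVal,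
      site_unitVec_ne (show r ≠ n by omega), show r ≠ 0 by omega, show r ≠ n by omega,
      site_unitVec_self (show 1 ≤ r + 1 by omega) (show r + 1 ≤ n by omega), qInt_one hs hgen,
      kkL, kkR, e]

/-- The image of `v_{l-1}` under `f_n` up to a scalar, which also makes sense for `l = 0`. -/
def uVec (n : ℕ) (s : K) (l : ℕ) : Fock K n ⊗[K] Fock K n :=
  ∑ p ∈ Finset.HasAntidiagonal.antidiagonal l,
    (-(imI K * s * ((s ^ 2) ^ p.1)⁻¹ * singCoeff s p)) • kk K n p.1 p.2

lemma sing_left {s : K} (hs : s ≠ 0) (hgen : ∀ k : ℕ, 0 < k → s ^ k ≠ 1) (a b : ℕ) :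
    qInt s (a + 1) * singCoeff s (a + 1, b) =
      imI K * s * (s ^ 2) ^ a * (s ^ 2) ^ b * singCoeff s (a, b) := by
  rw [singCoeff_succ_left hs hgen]
  ring

lemma sing_right {s : K} (hs : s ≠ 0) (hgen : ∀ k : ℕ, 0 < k → s ^ k ≠ 1) (a b : ℕ) :
    qInt s (b + 1) * singCoeff s (a, b + 1) = (s ^ 2) ^ a * singCoeff s (a, b) := by
  rw [singCoeff_succ_right hs hgen]
  ring

/-- Writing [a + b] = q^{-b} [a] + q^a [b] splits the right side into two sums; the recurrences of
`singCoeff` match them with the two terms of Δ f_n. -/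
lemma coprodF_last_vhat (hn : 1 ≤ n) {s : K} (hs : s ≠ 0)
    (hgen : ∀ k : ℕ, 0 < k → s ^ k ≠ 1) (l : ℕ) :
    coprodF n s n (vhat n s l) = qInt s (l + 1) • uVec n s (l + 1) := by
  have hI := imI_sq (K := K)
  rw [vhat, uVec, map_sum, Finset.smul_sum]
  symm
  calc _ = ∑ p ∈ Finset.HasAntidiagonal.antidiagonal (l + 1),
        (qInt s p.1 * (((s ^ 2) ^ p.2)⁻¹ * -(imI K * s * ((s ^ 2) ^ p.1)⁻¹ * singCoeff s p)) +
          qInt s p.2 * (-(imI K * s * singCoeff s p))) • kk K n p.1 p.2 := by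
        refine Finset.sum_congr rfl fun p hp => ?_
        rw [← Finset.HasAntidiagonal.mem_antidiagonal.mp hp, smul_smul, qInt_add' hs]
        congr 1
        have h1 : (s ^ 2) ^ p.1 ≠ 0 := pow_ne_zero _ (pow_ne_zero _ hs)
        field_simp
        ring
    _ = _ := by
        rw [sum_antidiagonal_split]
        refine Finset.sum_congr rfl fun p hp => ?_
        rw [map_smul, coprodF_last_kk hn, smul_add, smul_smul]
        have h1 : (s ^ 2) ^ p.1 ≠ 0 := pow_ne_zero _ (pow_ne_zero _ hs)
        have h2 : (s ^ 2) ^ p.2 ≠ 0 := pow_ne_zero _ (pow_ne_zero _ hs)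
        have h3 := sing_left hs hgen p.1 p.2
        have h4 := sing_right hs hgen p.1 p.2
        congr 2
        · rw [pow_succ]
          field_simp
          linear_combination (-(imI K)) * s * h3 - s ^ 2 * (s ^ 2) ^ p.1 * (s ^ 2) ^ p.2 * singCoeff s p * hI
        · linear_combination (-(imI K)) * s * h4

lemma creation_last_up (hn : 1 ≤ n) {s : K} (hs : s ≠ 0)
    (hgen : ∀ k : ℕ, 0 < k → s ^ k ≠ 1) (l : ℕ) :
    creR K n n (vhat n s l) + (-(s ^ 2) ^ l) • creL n s n (vhat n s l) =
      qInt s (l + 1) • vhat n s (l + 1) := by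
  rw [vhat, vhat, map_sum, map_sum, Finset.smul_sum, Finset.smul_sum, ← Finset.sum_add_distrib]
  symm
  calc _ = ∑ p ∈ Finset.HasAntidiagonal.antidiagonal (l + 1),
        (qInt s p.1 * ((s ^ 2) ^ p.2 * singCoeff s p) +
          qInt s p.2 * (((s ^ 2) ^ p.1)⁻¹ * singCoeff s p)) • kk K n p.1 p.2 := by
        refine Finset.sum_congr rfl fun p hp => ?_
        rw [← Finset.HasAntidiagonal.mem_antidiagonal.mp hp, smul_smul, qInt_add hs]
        congr 1
        ring
    _ = _ := by
        rw [sum_antidiagonal_split]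
        refine Finset.sum_congr rfl fun p hp => ?_
        rw [map_smul, map_smul, creR_last_kk, creL_last_kk hn, smul_smul, smul_smul, add_comm,
          ← Finset.HasAntidiagonal.mem_antidiagonal.mp hp]
        have h1 : (s ^ 2) ^ p.1 ≠ 0 := pow_ne_zero _ (pow_ne_zero _ hs)
        have h3 := sing_left hs hgen p.1 p.2
        have h4 := sing_right hs hgen p.1 p.2
        congr 2
        · field_simp
          linear_combination h4
        · rw [pow_add]
          linear_combination (s ^ 2) ^ p.2 * h3

/-- The coefficients of `uVec` make the two sides agree for each (a, b) separately, with no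
reindexing. -/
lemma creation_last_down (hn : 1 ≤ n) {s : K} (hs : s ≠ 0) (l : ℕ) :
    s ^ 2 • creR K n n (vhat n s l) + (-((s ^ 2) ^ l)⁻¹) • creL n s n (vhat n s l) =
      (-1 : K) • coprodF n s n (uVec n s l) := by
  have hI := imI_sq (K := K)
  simp only [vhat, uVec, map_sum, Finset.smul_sum]
  rw [← Finset.sum_add_distrib]
  refine Finset.sum_congr rfl fun p hp => ?_
  rw [map_smul, map_smul, map_smul, creR_last_kk, creL_last_kk hn, coprodF_last_kk hn, smul_smul,
    smul_smul, smul_add, smul_add, smul_smul, smul_smul, smul_smul, smul_smul, add_comm,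
    ← Finset.HasAntidiagonal.mem_antidiagonal.mp hp, pow_add]
  have h1 : (s ^ 2) ^ p.1 ≠ 0 := pow_ne_zero _ (pow_ne_zero _ hs)
  have h2 : (s ^ 2) ^ p.2 ≠ 0 := pow_ne_zero _ (pow_ne_zero _ hs)
  congr 2
  · field_simp
  · field_simp
    linear_combination singCoeff s p * hI

end core

/-! ### Creation at the sites j < n -/

section core

variable {n : ℕ} [Algebra ℂ K]

lemma creation_up {s : K} (hs : s ≠ 0) (hgen : ∀ k : ℕ, 0 < k → s ^ k ≠ 1) (l : ℕ)
    {d : ℕ} (hd : d + 1 < n) :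
    creR K n (n - (d + 1)) (vhat n s l) + (-(s ^ 2) ^ l) • creL n s (n - (d + 1)) (vhat n s l) =
      pathF n s (d + 1) (vhat n s (l + 1)) := by
  have hI := imI_sq (K := K)
  rw [vhat, vhat, map_sum, map_sum, map_sum, Finset.smul_sum, ← Finset.sum_add_distrib]
  simp only [map_smul, pathF_kk hs hgen _ _ hd, creR_kk, creL_kk s (show n - (d + 1) < n by omega)]
  simp only [smul_add, Finset.sum_add_distrib, smul_smul]
  rw [add_comm]
  congr 1
  · rw [Finset.Nat.sum_antidiagonal_succ]
    simp only [qInt_zero, mul_zero, zero_smul, zero_add, Nat.add_sub_cancel]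
    refine Finset.sum_congr rfl fun p hp => ?_
    rw [← Finset.HasAntidiagonal.mem_antidiagonal.mp hp, pow_add]
    congr 1
    linear_combination - sing_left hs hgen p.1 p.2
  · rw [Finset.Nat.sum_antidiagonal_succ']
    simp only [qInt_zero, mul_zero, zero_smul, zero_add, Nat.add_sub_cancel]
    refine Finset.sum_congr rfl fun p hp => ?_
    have h1 : (s ^ 2) ^ p.1 ≠ 0 := pow_ne_zero _ (pow_ne_zero _ hs)
    congr 1
    field_simp
    linear_combination - sing_right hs hgen p.1 p.2

/-- This and `coprodF_pathF_uVec` expand both orders of f_n and the path in the same vectors `kkL`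
and `kkR`, for `creation_down` to compare. Terms displaced to (a ± 1, b ∓ 1) are brought back by
`hA` and `hB`. -/
lemma pathF_coprodF_uVec (hn : 1 ≤ n) {s : K} (hs : s ≠ 0)
    (hgen : ∀ k : ℕ, 0 < k → s ^ k ≠ 1) (l : ℕ) {d : ℕ} (hd : d + 1 < n) :
    pathF n s (d + 1) (coprodF n s n (uVec n s l)) =
      ∑ p ∈ Finset.HasAntidiagonal.antidiagonal l,
        ((-(imI K * s * singCoeff s p *
            (((s ^ 2) ^ p.1)⁻¹ * qInt s (p.1 + 1) + (s ^ 2) ^ p.2 * qInt s p.2))) • kkL K n (n - (d + 1)) p.1 p.2 +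
          (-(s ^ 2 * ((s ^ 2) ^ p.1)⁻¹ * singCoeff s p *
            (qInt s (p.2 + 1) + ((s ^ 2) ^ (p.1 + p.2))⁻¹ * qInt s p.1))) •
            kkR K n (n - (d + 1)) p.1 p.2) := by
  have hI := imI_sq (K := K)
  have hA := sum_antidiagonal_shift l (kkR K n (n - (d + 1)))
    (fun p => -(imI K * s * ((s ^ 2) ^ p.1)⁻¹ * singCoeff s p) * (((s ^ 2) ^ (p.1 + 1))⁻¹ * qInt s p.2))
    (fun p => -(s ^ 2 * ((s ^ 2) ^ p.1)⁻¹ * singCoeff s p * (((s ^ 2) ^ (p.1 + p.2))⁻¹ * qInt s p.1)))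
    (by simp) (by simp) (by
      intro a b
      have h1 : (s ^ 2) ^ a ≠ 0 := pow_ne_zero _ (pow_ne_zero _ hs)
      have h2 : (s ^ 2) ^ b ≠ 0 := pow_ne_zero _ (pow_ne_zero _ hs)
      simp only [pow_succ _ a, pow_add]
      linear_combination (norm := skip) (-(s ^ 2 * ((s ^ 2) ^ a * s ^ 2)⁻¹ * ((s ^ 2) ^ a * s ^ 2 * (s ^ 2) ^ b)⁻¹)) * sing_left hs hgen a b -
        (-(imI K * s * ((s ^ 2) ^ a)⁻¹ * ((s ^ 2) ^ a * s ^ 2)⁻¹)) * sing_right hs hgen a b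
      field_simp
      ring)
  have hB := sum_antidiagonal_shift' l (kkL K n (n - (d + 1)))
    (fun p => -(imI K * s * ((s ^ 2) ^ p.1)⁻¹ * singCoeff s p) * -(imI K * s * (s ^ 2) ^ p.1) * qInt s p.1)
    (fun p => -(imI K * s * singCoeff s p * ((s ^ 2) ^ p.2 * qInt s p.2)))
    (by simp) (by simp) (by
      intro a b
      have h1 : (s ^ 2) ^ a ≠ 0 := pow_ne_zero _ (pow_ne_zero _ hs)
      have h2 : (s ^ 2) ^ b ≠ 0 := pow_ne_zero _ (pow_ne_zero _ hs)
      simp only [pow_succ _ a, pow_succ _ b]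
      linear_combination (norm := skip) (-(imI K * s * ((s ^ 2) ^ b * s ^ 2))) * sing_right hs hgen a b -
        ((imI K * s) ^ 2) * sing_left hs hgen a b
      field_simp
      linear_combination (-imI K * s ^ 3 * (s ^ 2) ^ b * (s ^ 2) ^ a * singCoeff s (a, b)) * hI)
  calc _ = ∑ p ∈ Finset.HasAntidiagonal.antidiagonal l,
        (((-(imI K * s * ((s ^ 2) ^ p.1)⁻¹ * singCoeff s p) * qInt s (p.1 + 1)) • kkL K n (n - (d + 1)) p.1 p.2 +
          (-(imI K * s * ((s ^ 2) ^ p.1)⁻¹ * singCoeff s p) * (((s ^ 2) ^ (p.1 + 1))⁻¹ * qInt s p.2)) • kkR K n (n - (d + 1)) (p.1 + 1) (p.2 - 1)) +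
        ((-(imI K * s * ((s ^ 2) ^ p.1)⁻¹ * singCoeff s p) * -(imI K * s * (s ^ 2) ^ p.1) * qInt s p.1) • kkL K n (n - (d + 1)) (p.1 - 1) (p.2 + 1) +
          (-(imI K * s * ((s ^ 2) ^ p.1)⁻¹ * singCoeff s p) * -(imI K * s * (s ^ 2) ^ p.1) * (((s ^ 2) ^ p.1)⁻¹ * qInt s (p.2 + 1))) • kkR K n (n - (d + 1)) p.1 p.2)) := by
        simp only [uVec, map_sum]
        refine Finset.sum_congr rfl fun p _ => ?_
        rw [map_smul, map_smul, coprodF_last_kk hn, map_add, map_smul, pathF_kk hs hgen _ _ hd,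
          pathF_kk hs hgen _ _ hd]
        simp only [smul_add, smul_smul, Nat.add_sub_cancel, mul_assoc]
    _ = _ := by
        rw [Finset.sum_add_distrib, Finset.sum_add_distrib, Finset.sum_add_distrib, hA, hB]
        simp only [← Finset.sum_add_distrib]
        refine Finset.sum_congr rfl fun p _ => ?_
        have h1 : (s ^ 2) ^ p.1 ≠ 0 := pow_ne_zero _ (pow_ne_zero _ hs)
        rw [add_add_add_comm, ← add_smul, ← add_smul]
        congr 2
        · ring
        · field_simp
          linear_combination (singCoeff s p * (s ^ 2) ^ p.1 * (s ^ 2) ^ p.2 * qInt s (p.2 + 1)) * hI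

lemma coprodF_pathF_uVec (hn : 1 ≤ n) {s : K} (hs : s ≠ 0)
    (hgen : ∀ k : ℕ, 0 < k → s ^ k ≠ 1) (l : ℕ) {d : ℕ} (hd : d + 1 < n) :
    coprodF n s n (pathF n s (d + 1) (uVec n s l)) =
      ∑ p ∈ Finset.HasAntidiagonal.antidiagonal l,
        ((-(imI K * s * singCoeff s p *
            (((s ^ 2) ^ p.1)⁻¹ * qInt s p.1 + (s ^ 2) ^ p.2 * (s ^ 2)⁻¹ * qInt s p.2))) • kkL K n (n - (d + 1)) p.1 p.2 +
          (-(s ^ 2 * ((s ^ 2) ^ p.1)⁻¹ * singCoeff s p *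
            (qInt s p.2 + s ^ 2 * ((s ^ 2) ^ (p.1 + p.2))⁻¹ * qInt s p.1))) •
            kkR K n (n - (d + 1)) p.1 p.2) := by
  have hI := imI_sq (K := K)
  have hA := sum_antidiagonal_shift l (kkR K n (n - (d + 1)))
    (fun p => -(imI K * s * ((s ^ 2) ^ p.1)⁻¹ * singCoeff s p) * (((s ^ 2) ^ p.1)⁻¹ * qInt s p.2))
    (fun p => -(s ^ 2 * ((s ^ 2) ^ p.1)⁻¹ * singCoeff s p * (s ^ 2 * ((s ^ 2) ^ (p.1 + p.2))⁻¹ * qInt s p.1)))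
    (by simp) (by simp) (by
      intro a b
      have h1 : (s ^ 2) ^ a ≠ 0 := pow_ne_zero _ (pow_ne_zero _ hs)
      have h2 : (s ^ 2) ^ b ≠ 0 := pow_ne_zero _ (pow_ne_zero _ hs)
      simp only [pow_succ _ a, pow_add]
      linear_combination (norm := skip) (-(s ^ 2 * ((s ^ 2) ^ a * s ^ 2)⁻¹ * s ^ 2 * ((s ^ 2) ^ a * s ^ 2 * (s ^ 2) ^ b)⁻¹)) * sing_left hs hgen a b -
        (-(imI K * s * ((s ^ 2) ^ a)⁻¹ * ((s ^ 2) ^ a)⁻¹)) * sing_right hs hgen a b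
      field_simp
      ring)
  have hB := sum_antidiagonal_shift' l (kkL K n (n - (d + 1)))
    (fun p => -(imI K * s * ((s ^ 2) ^ p.1)⁻¹ * singCoeff s p) * -(imI K * s * (s ^ 2) ^ p.1) * (s ^ 2)⁻¹ * qInt s p.1)
    (fun p => -(imI K * s * singCoeff s p * ((s ^ 2) ^ p.2 * (s ^ 2)⁻¹ * qInt s p.2)))
    (by simp) (by simp) (by
      intro a b
      have h1 : (s ^ 2) ^ a ≠ 0 := pow_ne_zero _ (pow_ne_zero _ hs)
      have h2 : (s ^ 2) ^ b ≠ 0 := pow_ne_zero _ (pow_ne_zero _ hs)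
      simp only [pow_succ _ a, pow_succ _ b]
      linear_combination (norm := skip) (-(imI K * s * ((s ^ 2) ^ b))) * sing_right hs hgen a b -
        ((imI K * s) ^ 2 * (s ^ 2)⁻¹) * sing_left hs hgen a b
      field_simp
      linear_combination (-imI K * s * (s ^ 2) ^ b * (s ^ 2) ^ a * singCoeff s (a, b)) * hI)
  calc _ = ∑ p ∈ Finset.HasAntidiagonal.antidiagonal l,
        (((-(imI K * s * ((s ^ 2) ^ p.1)⁻¹ * singCoeff s p) * qInt s p.1) • kkL K n (n - (d + 1)) p.1 p.2 +
          (-(imI K * s * ((s ^ 2) ^ p.1)⁻¹ * singCoeff s p) * (((s ^ 2) ^ p.1)⁻¹ * qInt s p.2)) • kkR K n (n - (d + 1)) (p.1 + 1) (p.2 - 1)) +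
        ((-(imI K * s * ((s ^ 2) ^ p.1)⁻¹ * singCoeff s p) * -(imI K * s * (s ^ 2) ^ p.1) * (s ^ 2)⁻¹ * qInt s p.1) • kkL K n (n - (d + 1)) (p.1 - 1) (p.2 + 1) +
          (-(imI K * s * ((s ^ 2) ^ p.1)⁻¹ * singCoeff s p) * (((s ^ 2) ^ p.1)⁻¹ * qInt s p.2) * -(imI K * s * (s ^ 2) ^ p.1)) • kkR K n (n - (d + 1)) p.1 p.2)) := by
        simp only [uVec, map_sum]
        refine Finset.sum_congr rfl fun p _ => ?_
        rw [map_smul, map_smul, pathF_kk hs hgen _ _ hd, map_add, map_smul, map_smul,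
          coprodF_last_kkL hn s (by omega), coprodF_last_kkR hn]
        simp only [smul_add, smul_smul]
        rw [add_add_add_comm]
        -- The index a − 1 + 1 or b − 1 + 1 is restored only away from zero; at zero the factor [0]
        -- vanishes.
        rcases p with ⟨a, b⟩
        congr 2
        · rcases a with - | a <;> simp
        · rcases a with - | a
          · simp
          · rw [Nat.add_sub_cancel, pow_succ]
            congr 1
            field_simp
        · rcases b with - | b <;> simp [mul_assoc]
    _ = _ := by
        rw [Finset.sum_add_distrib, Finset.sum_add_distrib, Finset.sum_add_distrib, hA, hB]
        simp only [← Finset.sum_add_distrib]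
        refine Finset.sum_congr rfl fun p _ => ?_
        have h1 : (s ^ 2) ^ p.1 ≠ 0 := pow_ne_zero _ (pow_ne_zero _ hs)
        rw [add_add_add_comm, ← add_smul, ← add_smul]
        congr 2
        · ring
        · field_simp
          linear_combination (singCoeff s p * (s ^ 2) ^ p.1 * (s ^ 2) ^ p.2 * qInt s p.2) * hI

/-- The combination of `pathF` and `f_n` that appears in the decomposition of the creation
operators. -/
def downOp (n : ℕ) (s : K) (l d : ℕ) : Module.End K (Fock K n ⊗[K] Fock K n) :=
  ((s ^ 2) ^ l - s ^ 2 * ((s ^ 2) ^ l)⁻¹) • (pathF n s d * coprodF n s n) +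
    (-(s ^ 2 * (s ^ 2) ^ l - ((s ^ 2) ^ l)⁻¹)) • (coprodF n s n * pathF n s d)

/-- The two scalars in `downOp` are those for which the quantum integers in each coefficient combine
into the required constant. The factor q − 1 on the left only clears a denominator. -/
lemma creation_down (hn : 1 ≤ n) {s : K} (hs : s ≠ 0) (hgen : ∀ k : ℕ, 0 < k → s ^ k ≠ 1) (l : ℕ)
    {d : ℕ} (hd : d + 1 < n) :
    (s ^ 2 - 1) • (s ^ 2 • creR K n (n - (d + 1)) (vhat n s l) +
      (-((s ^ 2) ^ l)⁻¹) • creL n s (n - (d + 1)) (vhat n s l)) =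
        downOp n s l (d + 1) (uVec n s l) := by
  have hq := sq_sub_inv_ne_zero hs hgen
  have hq4 : s ^ 4 - 1 ≠ 0 := sub_ne_zero.mpr (hgen 4 (by norm_num))
  rw [downOp, LinearMap.add_apply, LinearMap.smul_apply, LinearMap.smul_apply,
    Module.End.mul_apply, Module.End.mul_apply, pathF_coprodF_uVec hn hs hgen l hd,
    coprodF_pathF_uVec hn hs hgen l hd]
  simp only [vhat, map_sum, map_smul, Finset.smul_sum, creR_kk,
    creL_kk s (show n - (d + 1) < n by omega)]
  simp only [← Finset.sum_add_distrib, smul_add, smul_smul, Finset.smul_sum]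
  refine Finset.sum_congr rfl fun p hp => ?_
  rw [add_add_add_comm, ← add_smul, ← add_smul, add_comm,
    ← Finset.HasAntidiagonal.mem_antidiagonal.mp hp]
  have h1 : (s ^ 2) ^ p.1 ≠ 0 := pow_ne_zero _ (pow_ne_zero _ hs)
  have h2 : (s ^ 2) ^ p.2 ≠ 0 := pow_ne_zero _ (pow_ne_zero _ hs)
  simp only [qInt, pow_add, pow_succ _ p.1, pow_succ _ p.2]
  generalize (s ^ 2) ^ p.1 = Q at *
  generalize (s ^ 2) ^ p.2 = Q' at *
  congr 2
  · field_simp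
    ring
  · field_simp
    ring

end core

/-! ### The components span -/

/-- The determinant of the change of basis from `upVec, downVec`. -/
def creDet (s : K) (l : ℕ) : K := ((s ^ 2) ^ l)⁻¹ - s ^ 2 * (s ^ 2) ^ l

lemma creDet_ne_zero {s : K} (hs : s ≠ 0) (hgen : ∀ k : ℕ, 0 < k → s ^ k ≠ 1) (l : ℕ) :
    creDet s l ≠ 0 := by
  intro h
  have hq : (s ^ 2) ^ l ≠ 0 := pow_ne_zero _ (pow_ne_zero _ hs)
  unfold creDet at h
  field_simp at h
  refine sq_pow_ne_one hgen (m := 2 * l + 1) (by omega) ?_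
  rw [pow_succ, mul_comm 2 l, pow_mul]
  linear_combination - h

section span

variable {n : ℕ} [Algebra ℂ K]

/-- `W` is stable under `f_j, …, f_n`. -/
def FStable (n : ℕ) (s : K) (j : ℕ) (W : Submodule K (Fock K n ⊗[K] Fock K n)) : Prop :=
  ∀ r, j ≤ r → r ≤ n → ∀ w ∈ W, coprodF n s r w ∈ W

lemma FStable.pathF_mem {s : K} {d : ℕ} {W : Submodule K (Fock K n ⊗[K] Fock K n)}
    (hW : FStable n s (n - d) W) {w : Fock K n ⊗[K] Fock K n} (hw : w ∈ W) :
    pathF n s d w ∈ W := by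
  induction d with
  | zero => exact hw
  | succ d ih =>
    exact hW _ le_rfl (Nat.sub_le _ _) _ (ih fun r hr => hW r (by omega))

lemma FStable.uVec_mem (hn : 1 ≤ n) {s : K} (hs : s ≠ 0) (hgen : ∀ k : ℕ, 0 < k → s ^ k ≠ 1)
    {j : ℕ} (hj : j ≤ n) {W : Submodule K (Fock K n ⊗[K] Fock K n)} (hW : FStable n s j W) {l : ℕ}
    (hv : vhat n s (l - 1) ∈ W) : uVec n s l ∈ W := by
  rcases l with - | l
  -- With 0 − 1 = 0 the case l = 0 concerns V_0 itself, and u_0 is a multiple of v_0.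
  · have : uVec n s 0 = (-(imI K * s)) • vhat n s (0 - 1) := by
      simp [uVec, vhat, singCoeff]
    rw [this]
    exact W.smul_mem _ hv
  · have := hW n hj le_rfl _ hv
    rw [Nat.add_sub_cancel, coprodF_last_vhat hn hs hgen] at this
    exact (Submodule.smul_mem_iff _ (qInt_ne_zero hs hgen (Nat.succ_pos l))).mp this

/-- The component of the images of `v_l` under the creation operators in `V_{l+1}`. -/
def upVec (n : ℕ) (s : K) (j l : ℕ) : Fock K n ⊗[K] Fock K n :=
  creR K n j (vhat n s l) + (-(s ^ 2) ^ l) • creL n s j (vhat n s l)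

/-- The component of the images of `v_l` under the creation operators in `V_{l-1}`. -/
def downVec (n : ℕ) (s : K) (j l : ℕ) : Fock K n ⊗[K] Fock K n :=
  s ^ 2 • creR K n j (vhat n s l) + (-((s ^ 2) ^ l)⁻¹) • creL n s j (vhat n s l)

lemma FStable.upVec_mem (hn : 1 ≤ n) {s : K} (hs : s ≠ 0) (hgen : ∀ k : ℕ, 0 < k → s ^ k ≠ 1)
    {j : ℕ} (h1 : 1 ≤ j) (hj : j ≤ n) {W : Submodule K (Fock K n ⊗[K] Fock K n)}
    (hW : FStable n s j W) {l : ℕ} (hv : vhat n s (l + 1) ∈ W) : upVec n s j l ∈ W := by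
  rcases eq_or_lt_of_le hj with rfl | hj
  · rw [upVec, creation_last_up hn hs hgen]
    exact W.smul_mem _ hv
  · obtain ⟨d, rfl⟩ : ∃ d, j = n - (d + 1) := ⟨n - j - 1, by omega⟩
    rw [upVec, creation_up hs hgen l (by omega)]
    exact hW.pathF_mem hv

lemma FStable.downVec_mem (hn : 1 ≤ n) {s : K} (hs : s ≠ 0) (hgen : ∀ k : ℕ, 0 < k → s ^ k ≠ 1)
    {j : ℕ} (h1 : 1 ≤ j) (hj : j ≤ n) {W : Submodule K (Fock K n ⊗[K] Fock K n)}
    (hW : FStable n s j W) {l : ℕ} (hv : vhat n s (l - 1) ∈ W) : downVec n s j l ∈ W := by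
  have hu := hW.uVec_mem hn hs hgen hj hv
  rcases eq_or_lt_of_le hj with rfl | hj
  · rw [downVec, creation_last_down hn hs]
    exact W.smul_mem _ (hW _ le_rfl le_rfl _ hu)
  · obtain ⟨d, rfl⟩ : ∃ d, j = n - (d + 1) := ⟨n - j - 1, by omega⟩
    refine (Submodule.smul_mem_iff _ (sq_sub_one_ne_zero hgen)).mp ?_
    rw [downVec, creation_down hn hs hgen l (by omega), downOp]
    exact W.add_mem (W.smul_mem _ (hW.pathF_mem (hW n (by omega) le_rfl _ hu)))
      (W.smul_mem _ (hW n (by omega) le_rfl _ (hW.pathF_mem hu)))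

lemma creR_vhat_eq {s : K} (hs : s ≠ 0) (j l : ℕ) :
    creDet s l • creR K n j (vhat n s l) =
      ((s ^ 2) ^ l)⁻¹ • upVec n s j l + (-(s ^ 2) ^ l) • downVec n s j l := by
  have hq : (s ^ 2) ^ l ≠ 0 := pow_ne_zero _ (pow_ne_zero _ hs)
  rw [upVec, downVec, smul_add, smul_add, add_add_add_comm, smul_smul, smul_smul, smul_smul,
    ← add_smul, ← add_smul, creDet]
  convert (add_zero _).symm using 2
  · ring_nf
  · convert zero_smul K _
    field_simp
    ring

lemma creL_vhat_eq (s : K) (j l : ℕ) :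
    creDet s l • creL n s j (vhat n s l) =
      s ^ 2 • upVec n s j l + (-1 : K) • downVec n s j l := by
  rw [upVec, downVec, smul_add, smul_add, add_add_add_comm, smul_smul, smul_smul, smul_smul,
    ← add_smul, ← add_smul, creDet]
  convert (zero_add _).symm using 2
  · convert zero_smul K _
    ring
  · ring_nf

/-- The smallest subspace that contains all `v_l` and is stable under `f_j, …, f_n`. -/
def genSub (n : ℕ) (s : K) (j : ℕ) : Submodule K (Fock K n ⊗[K] Fock K n) :=
  sInf {W | (∀ l, vhat n s l ∈ W) ∧ FStable n s j W}

lemma vhat_mem_genSub (s : K) (j l : ℕ) : vhat n s l ∈ genSub n s j :=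
  Submodule.mem_sInf.mpr fun _ hW => hW.1 l

lemma genSub_stable (s : K) (j : ℕ) : FStable n s j (genSub n s j) := fun r h1 h2 w hw =>
  Submodule.mem_sInf.mpr fun W hW => hW.2 r h1 h2 w (Submodule.mem_sInf.mp hw W hW)

lemma genSub_anti (s : K) (j : ℕ) : genSub n s (j + 1) ≤ genSub n s j :=
  sInf_le ⟨vhat_mem_genSub s j, fun r hr => genSub_stable s j r (by omega)⟩

/-- Creation at site j commutes with f_j, …, f_n, so only the images of the v_l matter, and these
are combinations of `upVec` and `downVec`. -/
lemma creR_mem_genSub (hn : 1 ≤ n) {s : K} (hs : s ≠ 0) (hgen : ∀ k : ℕ, 0 < k → s ^ k ≠ 1)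
    {j : ℕ} (h1 : 1 ≤ j) (hj : j ≤ n) :
    genSub n s j ≤ (genSub n s j).comap (creR K n j) := by
  refine sInf_le ⟨fun l => ?_, fun r hr hr' w hw => ?_⟩
  · refine Submodule.mem_comap.mpr ((Submodule.smul_mem_iff _ (creDet_ne_zero hs hgen l)).mp ?_)
    rw [creR_vhat_eq hs]
    exact Submodule.add_mem _
      (Submodule.smul_mem _ _ ((genSub_stable s j).upVec_mem hn hs hgen h1 hj
        (vhat_mem_genSub s j _)))
      (Submodule.smul_mem _ _ ((genSub_stable s j).downVec_mem hn hs hgen h1 hj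
        (vhat_mem_genSub s j _)))
  · rw [Submodule.mem_comap, ← Module.End.mul_apply, creR_comm_coprodF h1 hr hr']
    exact genSub_stable s j r hr hr' _ hw

lemma creL_mem_genSub (hn : 1 ≤ n) {s : K} (hs : s ≠ 0) (hgen : ∀ k : ℕ, 0 < k → s ^ k ≠ 1)
    {j : ℕ} (h1 : 1 ≤ j) (hj : j ≤ n) :
    genSub n s j ≤ (genSub n s j).comap (creL n s j) := by
  refine sInf_le ⟨fun l => ?_, fun r hr hr' w hw => ?_⟩
  · refine Submodule.mem_comap.mpr ((Submodule.smul_mem_iff _ (creDet_ne_zero hs hgen l)).mp ?_)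
    rw [creL_vhat_eq]
    exact Submodule.add_mem _
      (Submodule.smul_mem _ _ ((genSub_stable s j).upVec_mem hn hs hgen h1 hj
        (vhat_mem_genSub s j _)))
      (Submodule.smul_mem _ _ ((genSub_stable s j).downVec_mem hn hs hgen h1 hj
        (vhat_mem_genSub s j _)))
  · rw [Submodule.mem_comap, ← Module.End.mul_apply, creL_comm_coprodF hn hs h1 hr hr']
    exact genSub_stable s j r hr hr' _ hw

/-- The induction admits one more site j = n − d at each step: empty it, apply the induction
hypothesis, and refill it in both factors by `creL` and `creR`. -/
lemma ket_mem_genSub (hn : 1 ≤ n) {s : K} (hs : s ≠ 0) (hgen : ∀ k : ℕ, 0 < k → s ^ k ≠ 1)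
    (d : ℕ) (hd : d ≤ n) (m m' : Fin n → ℕ)
    (h : ∀ i, i ≤ n - d → site m i = 0 ∧ site m' i = 0) :
    ket K m ⊗ₜ ket K m' ∈ genSub n s (n - d + 1) := by
  induction d generalizing m m' with
  | zero =>
    have e : m = 0 := ext_site fun j _ h2 => by simp [(h j (by omega)).1]
    have e' : m' = 0 := ext_site fun j _ h2 => by simp [(h j (by omega)).2]
    have := vhat_mem_genSub (n := n) s (n - 0 + 1) 0
    simpa [vhat, singCoeff, kk, e, e'] using this
  | succ d ih =>
    obtain ⟨j, hj⟩ : ∃ j, n - d = j := ⟨_, rfl⟩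
    have hj' : n - (d + 1) + 1 = j := by omega
    have hL := creL_mem_genSub hn hs hgen (show 1 ≤ j by omega) (show j ≤ n by omega)
    have hR := creR_mem_genSub hn hs hgen (show 1 ≤ j by omega) (show j ≤ n by omega)
    have hRa : ∀ (a : ℕ) (m m' : Fin n → ℕ), ket K m ⊗ₜ ket K m' ∈ genSub n s j →
        ket K m ⊗ₜ ket K (m' + a • unitVec n j) ∈ genSub n s j := by
      intro a m m' hm
      induction a with
      | zero => simpa using hm
      | succ a ih =>
        have := hR ih
        simpa [creR, add_smul, add_assoc, -nsmul_eq_mul] using this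
    have hLa : ∀ (a : ℕ) (m m' : Fin n → ℕ), ket K m ⊗ₜ ket K m' ∈ genSub n s j →
        ket K (m + a • unitVec n j) ⊗ₜ ket K m' ∈ genSub n s j := by
      intro a m m' hm
      induction a with
      | zero => simpa using hm
      | succ a ih =>
        have := hL ih
        rw [Submodule.mem_comap, creL, TensorProduct.map_tmul, cre_ket, dg_ket,
          TensorProduct.tmul_smul, siteVal, Submodule.smul_mem_iff _
          (neg_ne_zero.mpr (mul_ne_zero imI_ne_zero (pow_ne_zero _ hs)))] at this
        simpa [add_smul, add_assoc, -nsmul_eq_mul] using this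
    have split : ∀ m : Fin n → ℕ, m - site m j • unitVec n j + site m j • unitVec n j = m := by
      intro m
      refine ext_site fun i h1 h2 => ?_
      by_cases hi : i = j
      · subst hi; simp [site_unitVec_self h1 h2, -nsmul_eq_mul]
      · simp [site_unitVec_ne hi, -nsmul_eq_mul]
    rw [hj', ← split m, ← split m']
    refine hLa _ _ _ (hRa _ _ _ (genSub_anti s j ?_))
    have key := ih (by omega) (m - site m j • unitVec n j) (m' - site m' j • unitVec n j)
    rw [hj] at key
    refine key fun i hi => ?_
    by_cases hij : i = j
    · subst hij
      simp [site_unitVec_self (show 1 ≤ i by omega) (show i ≤ n by omega), -nsmul_eq_mul]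
    · have := h i (by omega)
      simp [this.1, this.2, site_unitVec_ne hij, -nsmul_eq_mul]

end span

/-- The basis of kets of `V ⊗ V`. -/
def ketBasis (K : Type*) [Field K] (n : ℕ) :
    Module.Basis ((Fin n → ℕ) × (Fin n → ℕ)) K (Fock K n ⊗[K] Fock K n) :=
  Module.Basis.tensorProduct Finsupp.basisSingleOne Finsupp.basisSingleOne

lemma ketBasis_apply {n : ℕ} (m m' : Fin n → ℕ) :
    ketBasis K n (m, m') = ket K m ⊗ₜ ket K m' := by
  simp [ketBasis, ket]

lemma eq_top_of_ket_mem {n : ℕ} {W : Submodule K (Fock K n ⊗[K] Fock K n)}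
    (h : ∀ m m', ket K m ⊗ₜ ket K m' ∈ W) : W = ⊤ := by
  rw [eq_top_iff, ← (ketBasis K n).span_eq, Submodule.span_le]
  rintro _ ⟨⟨m, m'⟩, rfl⟩
  rw [ketBasis_apply]
  exact h m m'

lemma iSup_component [Algebra ℂ K] {n : ℕ} (hn : 1 ≤ n) {s : K} (hs : s ≠ 0)
    (hgen : ∀ k : ℕ, 0 < k → s ^ k ≠ 1) : ⨆ l, component n s l = ⊤ := by
  refine eq_top_of_ket_mem fun m m' => ?_
  have h1 : genSub n s 1 ≤ ⨆ l, component n s l := by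
    refine sInf_le ⟨fun l => Submodule.mem_iSup_of_mem l (vhat_mem hs hgen l), ?_⟩
    intro r h1 h2 w hw
    refine Submodule.iSup_induction (component n s)
      (motive := fun w => coprodF n s r w ∈ ⨆ l, component n s l) hw ?_ ?_ ?_
    · exact fun l w hw => Submodule.mem_iSup_of_mem l (coprodF_mem h1 h2 hw)
    · rw [map_zero]; exact Submodule.zero_mem _
    · intro w w' hw hw'
      rw [map_add]; exact Submodule.add_mem _ hw hw'
  refine h1 ?_
  have := ket_mem_genSub (K := K) hn hs hgen n le_rfl m m' (fun i hi => by
    have : i = 0 := by omega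
    subst this
    simp [site])
  simpa using this

/-! ### The contravariant form -/

section form

variable {n : ℕ}

/-- The squared length of `|𝐦⟩` for the contravariant form. -/
def weight (s : K) (m : Fin n → ℕ) : K := ∏ a : Fin n, qFactorial s (m a) * s ^ (m a ^ 2)

lemma weight_ne_zero {s : K} (hs : s ≠ 0) (hgen : ∀ k : ℕ, 0 < k → s ^ k ≠ 1) (m : Fin n → ℕ) :
    weight s m ≠ 0 :=
  Finset.prod_ne_zero_iff.mpr fun _ _ =>
    mul_ne_zero (qFactorial_ne_zero hs hgen _) (pow_ne_zero _ hs)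

lemma weight_add (s : K) (m : Fin n → ℕ) {j : ℕ} (h1 : 1 ≤ j) (h2 : j ≤ n) :
    weight s (m + unitVec n j) =
      weight s m * (qInt s (site m j + 1) * s ^ (2 * site m j + 1)) := by
  have : ∀ a : Fin n, qFactorial s ((m + unitVec n j) a) * s ^ ((m + unitVec n j) a ^ 2) =
      qFactorial s (m a) * s ^ (m a ^ 2) *
        if a = ⟨j - 1, by omega⟩ then qInt s (site m j + 1) * s ^ (2 * site m j + 1) else 1 := by
    intro a
    have h : a = ⟨j - 1, by omega⟩ ↔ (a : ℕ) + 1 = j := by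
      rw [Fin.ext_iff]
      change (a : ℕ) = j - 1 ↔ _
      omega
    simp only [h, Pi.add_apply, unitVec]
    split_ifs with hj
    · subst hj
      simp only [site, show 1 ≤ (a : ℕ) + 1 ∧ (a : ℕ) + 1 ≤ n by omega, Nat.add_sub_cancel,
        qFactorial_succ, Fin.eta, dite_true, and_self]
      ring
    · simp
  simp only [weight, this, Finset.prod_mul_distrib, Finset.prod_ite_eq', Finset.mem_univ, if_true]

/-- The contravariant form on the Fock space. -/
def form₁ (n : ℕ) (s : K) : Fock K n →ₗ[K] Module.Dual K (Fock K n) :=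
  Finsupp.linearCombination K fun m => weight s m • Finsupp.lapply m

lemma form₁_ket (s : K) (m : Fin n → ℕ) (v : Fock K n) :
    form₁ n s (ket K m) v = weight s m * v m := by
  simp [form₁, ket]

lemma form₁_comm (s : K) (u v : Fock K n) : form₁ n s u v = form₁ n s v u := by
  have : form₁ n s = (form₁ n s).flip := by
    refine fock_ext fun m => fock_ext fun m' => ?_
    rw [LinearMap.flip_apply, form₁_ket, form₁_ket, ket, ket, Finsupp.single_apply,
      Finsupp.single_apply]
    by_cases h : m = m'
    · simp [h]
    · simp [h, Ne.symm h]
  exact LinearMap.congr_fun₂ this u v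

lemma form₁_dg (s : K) (χ : (Fin n → ℕ) → K) (u v : Fock K n) :
    form₁ n s (dg χ u) v = form₁ n s u (dg χ v) := by
  have : form₁ n s ∘ₗ dg χ = (LinearMap.lcomp K K (dg χ)) ∘ₗ form₁ n s := by
    refine fock_ext fun m => fock_ext fun m' => ?_
    simp only [LinearMap.comp_apply, dg_ket, map_smul, LinearMap.smul_apply,
      LinearMap.lcomp_apply, form₁_ket]
    rw [ket, Finsupp.single_apply]
    by_cases h : m' = m
    · simp [h]
    · simp [h]
  exact LinearMap.congr_fun₂ this u v

/-- The eigenvalue `q ^ (m_j - 1/2)`. -/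
def eta (n : ℕ) (s : K) (j : ℕ) (m : Fin n → ℕ) : K := s ^ (2 * site m j) * s⁻¹

lemma eta_shift {s : K} (hs : s ≠ 0) (j : ℕ) :
    HasShift (eta n s j) fun a => (s ^ 2) ^ (if a = j then 1 else 0 : ℤ) := by
  intro a h1 h2
  refine ⟨zpow_ne_zero _ (pow_ne_zero _ hs), fun m => ?_⟩
  simp only [eta, site_add, site_unitVec]
  split_ifs <;> first | omega | skip
  · rw [zpow_one]
    ring
  · simp

/-- The factor q^{m²/2} in `weight` is what inserts `eta` here; it makes the transpose of e_r a
multiple of f_r k_r. -/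
lemma form₁_cre {s : K} (hs : s ≠ 0) {j : ℕ} (h1 : 1 ≤ j) (h2 : j ≤ n) (u v : Fock K n) :
    form₁ n s (cre K n j u) v = form₁ n s u (ann n s j (dg (eta n s j) v)) := by
  have : form₁ n s ∘ₗ cre K n j =
      (LinearMap.lcomp K K (ann n s j ∘ₗ dg (eta n s j))) ∘ₗ form₁ n s := by
    refine fock_ext fun m => fock_ext fun m' => ?_
    simp only [LinearMap.comp_apply, cre_ket, ann_ket, dg_ket, map_smul,
      LinearMap.lcomp_apply, form₁_ket, weight_add s m h1 h2]
    by_cases h : m' = m + unitVec n j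
    · subst h
      rw [add_tsub_cancel_right]
      simp only [ket, Finsupp.single_eq_same, eta, site_add, site_unitVec_self h1 h2, smul_eq_mul]
      have : s ^ (2 * (site m j + 1)) * s⁻¹ = s ^ (2 * site m j + 1) := by
        rw [show 2 * (site m j + 1) = 2 * site m j + 1 + 1 by ring, pow_succ s (2 * site m j + 1),
          mul_inv_cancel_right₀ hs]
      rw [this]
      ring
    · rw [ket, Finsupp.single_eq_of_ne (Ne.symm h), mul_zero]
      by_cases hz : site m' j = 0
      · simp [hz]
      · have : m ≠ m' - unitVec n j := by
          rintro rfl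
          exact h (tsub_add_cancel_of_le (unitVec_le hz)).symm
        rw [ket, Finsupp.single_eq_of_ne this]
        simp
  exact LinearMap.congr_fun₂ this u v

lemma form₁_ann {s : K} (hs : s ≠ 0) {j : ℕ} (h1 : 1 ≤ j) (h2 : j ≤ n) (u v : Fock K n) :
    form₁ n s (ann n s j u) v =
      form₁ n s u (dg (fun m => (eta n s j m)⁻¹) (cre K n j v)) := by
  have hη : ∀ m : Fin n → ℕ, eta n s j m ≠ 0 := fun m =>
    mul_ne_zero (pow_ne_zero _ hs) (inv_ne_zero hs)
  rw [← form₁_dg, form₁_comm s _ (cre K n j v), form₁_cre hs h1 h2, ← Module.End.mul_apply (dg _),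
    dg_mul_dg_inv hη, Module.End.one_apply, form₁_comm]

/-- The contravariant form on `V ⊗ V`. -/
def form₂ (n : ℕ) (s : K) : Fock K n ⊗[K] Fock K n →ₗ[K] Module.Dual K (Fock K n ⊗[K] Fock K n) :=
  TensorProduct.dualDistrib K (Fock K n) (Fock K n) ∘ₗ TensorProduct.map (form₁ n s) (form₁ n s)

lemma form₂_tmul (s : K) (a b a' b' : Fock K n) :
    form₂ n s (a ⊗ₜ b) (a' ⊗ₜ b') = form₁ n s a a' * form₁ n s b b' := by
  simp [form₂]

lemma form₂_comm (s : K) (u v : Fock K n ⊗[K] Fock K n) : form₂ n s u v = form₂ n s v u := by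
  have : form₂ n s = (form₂ n s).flip := by
    refine tensor_ext fun a b => tensor_ext fun a' b' => ?_
    rw [LinearMap.flip_apply, form₂_tmul, form₂_tmul, form₁_comm s (ket K a),
      form₁_comm s (ket K b)]
  exact LinearMap.congr_fun₂ this u v

lemma form₂_ket (s : K) (m m' : Fin n → ℕ) (v : Fock K n ⊗[K] Fock K n) :
    form₂ n s (ket K m ⊗ₜ ket K m') v =
      weight s m * weight s m' * (ketBasis K n).repr v (m, m') := by
  have : form₂ n s (ket K m ⊗ₜ ket K m') =
      (weight s m * weight s m') • (ketBasis K n).coord (m, m') := by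
    refine (ketBasis K n).ext ?_
    rintro ⟨a, b⟩
    rw [LinearMap.smul_apply, Module.Basis.coord_apply, Module.Basis.repr_self, ketBasis_apply,
      form₂_tmul, form₁_ket, form₁_ket, ket, ket, Finsupp.single_apply, Finsupp.single_apply,
      Finsupp.single_apply, smul_eq_mul]
    by_cases h1 : a = m <;> by_cases h2 : b = m' <;> simp [h1, h2]
  rw [this]
  rfl

/-- Kets are orthogonal and their lengths are nonzero, so the form reads off every coordinate. -/
lemma form₂_injective {s : K} (hs : s ≠ 0) (hgen : ∀ k : ℕ, 0 < k → s ^ k ≠ 1)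
    {u v : Fock K n ⊗[K] Fock K n} (h : ∀ w, form₂ n s w u = form₂ n s w v) : u = v := by
  refine (ketBasis K n).repr.injective (Finsupp.ext fun p => ?_)
  have := h (ket K p.1 ⊗ₜ ket K p.2)
  rw [form₂_ket, form₂_ket] at this
  exact mul_left_cancel₀ (mul_ne_zero (weight_ne_zero hs hgen _) (weight_ne_zero hs hgen _)) this

lemma form₂_dg₂ (s : K) (χ : (Fin n → ℕ) → K) (u v : Fock K n ⊗[K] Fock K n) :
    form₂ n s (dg₂ χ u) v = form₂ n s u (dg₂ χ v) := by
  have : form₂ n s ∘ₗ dg₂ χ = (LinearMap.lcomp K K (dg₂ χ)) ∘ₗ form₂ n s := by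
    refine tensor_ext fun a b => tensor_ext fun a' b' => ?_
    simp only [LinearMap.comp_apply, dg₂, LinearMap.lcomp_apply, TensorProduct.map_tmul, form₂_tmul,
      form₁_dg]
  exact LinearMap.congr_fun₂ this u v

variable [Algebra ℂ K]

/-- The constants `c_r` with `e_rᵀ = c_r f_r k_r` for `x = 1`. -/
def adjCoeff (n : ℕ) (s : K) (r : ℕ) : K :=
  if r = 0 then (s ^ 2)⁻¹ * (kappa s)⁻¹ else if r = n then kappa s else (s ^ 2)⁻¹

lemma form₁_opE (hn : 1 ≤ n) {s : K} (hs : s ≠ 0) (hgen : ∀ k : ℕ, 0 < k → s ^ k ≠ 1) (x : K)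
    {r : ℕ} (hr : r ≤ n) (u v : Fock K n) :
    form₁ n s (opE n s x r u) v = (if r = 0 then x else 1) * adjCoeff n s r *
      form₁ n s u (opF n s 1 r (opK n s r v)) := by
  have hI := imI_sq (K := K)
  have hκ := kappa_ne_zero hgen
  have hdg : ∀ (χ ψ : (Fin n → ℕ) → K) (c : K), (∀ m, χ m = c * ψ m) → dg χ = c • dg ψ := by
    intro χ ψ c h
    refine fock_ext fun m => ?_
    simp [h, smul_smul]
  rcases Nat.eq_zero_or_pos r with rfl | h1
  · have h : opK n s 0 = (-(imI K * s ^ 2)) • dg (eta n s 1) := hdg _ _ _ fun m => by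
      simp only [kVal, eta, if_true]
      field_simp
      ring
    rw [opE_zero, LinearMap.smul_apply, map_smul, LinearMap.smul_apply, form₁_cre hs le_rfl hn,
      opF_zero, h]
    simp only [LinearMap.smul_apply, map_smul, smul_eq_mul, adjCoeff, if_true]
    field_simp
    linear_combination (x * form₁ n s u (ann n s 1 (dg (eta n s 1) v))) * hI
  rcases eq_or_lt_of_le hr with rfl | hr
  · have h : opK r s r = (imI K * (s ^ 2)⁻¹) • dg (fun m => (eta r s r m)⁻¹) :=
      hdg _ _ _ fun m => by
        simp only [kVal, eta, if_true, show r ≠ 0 by omega, if_false]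
        field_simp
        ring
    have h' := (eta_shift (n := r) hs r).inv.dg_mul_cre h1 le_rfl
    rw [opE_last h1, LinearMap.smul_apply, map_smul, LinearMap.smul_apply, form₁_ann hs h1 le_rfl,
      ← Module.End.mul_apply (dg _), h', opF_last h1, h]
    simp only [LinearMap.smul_apply, map_smul, smul_eq_mul, adjCoeff, if_true, h1.ne', if_false,
      Module.End.mul_apply, zpow_one]
    ring
  · have h : dg (fun m => (eta n s r m)⁻¹) * dg (eta n s (r + 1)) = opK n s r := by
      rw [dg_mul_dg, opK_eq]
      congr 1
      funext m
      simp only [kVal, eta, h1.ne', hr.ne, if_false, zpow_add₀ (pow_ne_zero 2 hs), zpow_neg,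
        zpow_natCast, pow_mul]
      field_simp
    have h' := (eta_shift (n := n) hs r).inv.dg_mul_opF s 1 h1 hr.le
    have h'' : shiftF n (fun j => ((s ^ 2) ^ (if j = r then 1 else 0 : ℤ))⁻¹) r = (s ^ 2)⁻¹ := by
      simp [shiftF, hr.ne]
    rw [opE_mid s x h1 hr, Module.End.mul_apply, form₁_cre hs (by omega) hr, form₁_ann hs h1 hr.le,
      ← Module.End.mul_apply (cre K n r), ← opF_mid s 1 h1 hr, ← Module.End.mul_apply (dg _),
      h', h'', ← h]
    simp only [LinearMap.smul_apply, map_smul, smul_eq_mul, adjCoeff, h1.ne', hr.ne, if_false,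
      Module.End.mul_apply, one_mul]

lemma opF_scale (s x : K) (r : ℕ) :
    opF n s x r = (if r = 0 then x⁻¹ else 1) • opF n s 1 r := by
  rcases Nat.eq_zero_or_pos r with rfl | h1
  · rw [opF_zero, opF_zero, if_pos rfl, smul_smul]
    congr 1
    simp only [inv_one]
    ring
  · rw [if_neg h1.ne', one_smul, opF_param s x 1 h1]

/-- The transpose of `Δ e_r` is a multiple of `Δ (f_r k_r)`, with the spectral parameters
interchanged. -/
lemma form₂_copE (hn : 1 ≤ n) {s x y : K} (hs : s ≠ 0) (hgen : ∀ k : ℕ, 0 < k → s ^ k ≠ 1)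
    (hx : x ≠ 0) (hy : y ≠ 0) {r : ℕ} (hr : r ≤ n) (u v : Fock K n ⊗[K] Fock K n) :
    form₂ n s (copE n s x y r u) v = (if r = 0 then x * y else 1) * adjCoeff n s r *
      form₂ n s u (copF n s y x r (dg₂ (kVal n s r) v)) := by
  have : form₂ n s ∘ₗ copE n s x y r = ((if r = 0 then x * y else 1) * adjCoeff n s r) •
      (LinearMap.lcomp K K (copF n s y x r ∘ₗ dg₂ (kVal n s r))) ∘ₗ form₂ n s := by
    refine tensor_ext fun a b => tensor_ext fun a' b' => ?_
    generalize ket K a = a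
    generalize ket K b = b
    generalize ket K a' = a'
    generalize ket K b' = b'
    have hk : opKinv n s r (opK n s r a') = a' := by
      rw [← Module.End.mul_apply, opK_eq, opKinv_eq, dg_comm, dg_mul_dg_inv (kVal_ne_zero hs r)]
      rfl
    simp only [LinearMap.comp_apply, LinearMap.smul_apply, LinearMap.lcomp_apply, copE, copF, dg₂,
      ← opK_eq, LinearMap.add_apply, TensorProduct.map_tmul, map_add, form₂_tmul, smul_eq_mul,
      LinearMap.id_apply, form₁_opE hn hs hgen _ hr, opF_scale s x, opF_scale s y, hk, map_smul]
    rw [opK_eq, form₁_dg, ← opK_eq]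
    -- For r = 0, e_0 in the factor with parameter x contributes x = xy · y⁻¹, that is, f_0 with
    -- parameter y; hence the interchange.
    split_ifs
    · field_simp
      ring
    · ring
  exact LinearMap.congr_fun₂ this u v

end form

/-! ### The direct sum decomposition -/

section decomposition

variable {n : ℕ}

lemma adjCoeff_ne_zero {s : K} (hs : s ≠ 0) (hgen : ∀ k : ℕ, 0 < k → s ^ k ≠ 1) (r : ℕ) :
    adjCoeff n s r ≠ 0 := by
  have := kappa_ne_zero hgen
  unfold adjCoeff
  split_ifs
  · exact mul_ne_zero (inv_ne_zero (pow_ne_zero _ hs)) (inv_ne_zero this)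
  · exact this
  · exact inv_ne_zero (pow_ne_zero _ hs)

lemma dg₂_mul_dg₂_inv {χ : (Fin n → ℕ) → K} (h : ∀ m, χ m ≠ 0)
    (u : Fock K n ⊗[K] Fock K n) : dg₂ χ (dg₂ (fun m => (χ m)⁻¹) u) = u := by
  rw [← Module.End.mul_apply, dg₂, dg₂, map_mul_map, dg_mul_dg_inv h, TensorProduct.map_one]
  rfl

lemma sq_pow_injective {s : K} (hs : s ≠ 0) (hgen : ∀ k : ℕ, 0 < k → s ^ k ≠ 1) :
    Function.Injective fun l : ℕ => (s ^ 2) ^ l := by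
  have key : ∀ a b : ℕ, (s ^ 2) ^ a = (s ^ 2) ^ (a + b) → b = 0 := by
    intro a b h
    by_contra hb
    rw [pow_add] at h
    exact sq_pow_ne_one hgen (Nat.pos_of_ne_zero hb)
      (mul_left_cancel₀ (pow_ne_zero a (pow_ne_zero 2 hs)) (by rw [← h, mul_one]))
  intro a b h
  rcases le_total a b with hab | hab
  · obtain ⟨c, rfl⟩ := Nat.exists_eq_add_of_le hab
    rw [key a c h, add_zero]
  · obtain ⟨c, rfl⟩ := Nat.exists_eq_add_of_le hab
    rw [key b c h.symm, add_zero]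

variable [Algebra ℂ K]

lemma form₂_coprodF (hn : 1 ≤ n) {s : K} (hs : s ≠ 0) (hgen : ∀ k : ℕ, 0 < k → s ^ k ≠ 1)
    {r : ℕ} (h1 : 1 ≤ r) (hr : r ≤ n) (u v : Fock K n ⊗[K] Fock K n) :
    form₂ n s u (coprodF n s r v) = (adjCoeff n s r)⁻¹ *
      form₂ n s (copE n s 1 1 r u) (dg₂ (fun m => (kVal n s r m)⁻¹) v) := by
  rw [form₂_copE hn hs hgen one_ne_zero one_ne_zero hr, if_neg (by omega), one_mul,
    inv_mul_cancel_left₀ (adjCoeff_ne_zero hs hgen r), dg₂_mul_dg₂_inv (kVal_ne_zero hs r),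
    copF_param s 1 1 h1]

/-- `dg₂ (eta n s n)` is self-adjoint and its eigenvalues q^l · const on these vectors are distinct,
as q is not a root of unity. -/
lemma form₂_vhat (hn : 1 ≤ n) {s : K} (hs : s ≠ 0) (hgen : ∀ k : ℕ, 0 < k → s ^ k ≠ 1)
    {l l' : ℕ} (hl : l ≠ l') : form₂ n s (vhat n s l) (vhat n s l') = 0 := by
  have h := form₂_dg₂ s (eta n s n) (vhat n s l) (vhat n s l')
  have hη : eta n s n 0 ≠ 0 := mul_ne_zero (pow_ne_zero _ hs) (inv_ne_zero hs)
  rw [(eta_shift hs n).dg₂_vhat hn, (eta_shift hs n).dg₂_vhat hn, map_smul, map_smul,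
    LinearMap.smul_apply, smul_eq_mul, smul_eq_mul, if_pos rfl, zpow_one] at h
  by_contra h0
  exact hl (sq_pow_injective hs hgen (mul_right_cancel₀ (pow_ne_zero 2 hη) (mul_right_cancel₀ h0 h)))

lemma form₂_component (hn : 1 ≤ n) {s : K} (hs : s ≠ 0) (hgen : ∀ k : ℕ, 0 < k → s ^ k ≠ 1)
    {l l' : ℕ} (hl : l ≠ l') {u v : Fock K n ⊗[K] Fock K n} (hu : u ∈ component n s l)
    (hv : v ∈ component n s l') : form₂ n s u v = 0 := by
  -- Any f_r in the second argument becomes e_r on the singular vector, which is zero.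
  have hvec : ∀ v ∈ component n s l', form₂ n s (vhat n s l) v = 0 := by
    intro v hv
    refine component_le (W := LinearMap.ker (form₂ n s (vhat n s l))) ?_ ?_ hv
    · rw [LinearMap.mem_ker, singularVec_eq, map_smul, form₂_vhat hn hs hgen hl, smul_zero]
    · intro r h1 h2 w _ _
      rw [LinearMap.mem_ker, form₂_coprodF hn hs hgen h1 h2, copE_vhat hn hs hgen h1 h2, map_zero,
        LinearMap.zero_apply, mul_zero]
  -- Now f_r in the first argument becomes e_r in the second, so orthogonality must be proved
  -- against all of V_{l'} at once.
  have key : component n s l ≤ ⨅ v : component n s l', LinearMap.ker ((form₂ n s).flip v) := by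
    refine component_le ?_ ?_
    · simp only [Submodule.mem_iInf, LinearMap.mem_ker, LinearMap.flip_apply]
      intro v
      rw [singularVec_eq, map_smul, LinearMap.smul_apply, hvec v v.2, smul_zero]
    · simp only [Submodule.mem_iInf, LinearMap.mem_ker, LinearMap.flip_apply]
      intro r h1 h2 w _ hw v
      rw [form₂_comm, form₂_coprodF hn hs hgen h1 h2, ← form₂_dg₂, form₂_comm]
      rw [hw ⟨_, (kVal_shift hn hs).inv.dg₂_mem hn (copE_mem hn hs hgen h1 h2 v.2)⟩, mul_zero]
  have := key hu
  simp only [Submodule.mem_iInf, LinearMap.mem_ker, LinearMap.flip_apply] at this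
  exact this ⟨v, hv⟩

lemma component_induction (hn : 1 ≤ n) {s : K} (hs : s ≠ 0) (hgen : ∀ k : ℕ, 0 < k → s ^ k ≠ 1)
    {p : Fock K n ⊗[K] Fock K n → Prop} (h : ∀ l, ∀ w ∈ component n s l, p w)
    (hadd : ∀ w w', p w → p w' → p (w + w')) (w : Fock K n ⊗[K] Fock K n) : p w := by
  have hw : w ∈ ⨆ l, component n s l := by
    rw [iSup_component hn hs hgen]
    exact Submodule.mem_top
  exact Submodule.iSup_induction (component n s) (motive := p) hw h
    (h 0 0 (Submodule.zero_mem _)) hadd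

lemma component_ext (hn : 1 ≤ n) {s : K} (hs : s ≠ 0) (hgen : ∀ k : ℕ, 0 < k → s ^ k ≠ 1)
    {M : Type*} [AddCommMonoid M] [Module K M] {f g : Fock K n ⊗[K] Fock K n →ₗ[K] M}
    (h : ∀ l, ∀ w ∈ component n s l, f w = g w) : f = g :=
  LinearMap.ext fun w => component_induction hn hs hgen (p := fun w => f w = g w) h
    (fun w w' hw hw' => by rw [map_add, map_add, hw, hw']) w

/-- By `hform`, pairing with V_l sees only the l-th summand. So two decompositions of one vector
have summands with equal pairings against every V_i, hence against everything, and nondegeneracy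
identifies them. -/
lemma isInternal_component (hn : 1 ≤ n) {s : K} (hs : s ≠ 0)
    (hgen : ∀ k : ℕ, 0 < k → s ^ k ≠ 1) :
    DirectSum.IsInternal (component (K := K) n s) := by
  have hform : ∀ (l : ℕ), ∀ w ∈ component n s l, ∀ x : DirectSum ℕ fun l => component n s l,
      form₂ n s w (DirectSum.coeLinearMap (component n s) x) = form₂ n s w (x l) := by
    intro l w hw x
    induction x using DirectSum.induction_on with
    | zero => simp
    | of i y =>
      rw [DirectSum.coeLinearMap_of]
      by_cases hi : i = l
      · subst hi
        rw [DirectSum.of_eq_same]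
      · rw [DirectSum.of_eq_of_ne _ _ _ (Ne.symm hi), Submodule.coe_zero, map_zero,
          form₂_component hn hs hgen (Ne.symm hi) hw y.2]
    | add x y hx hy =>
      rw [map_add, map_add, hx, hy, DirectSum.add_apply, Submodule.coe_add, map_add]
  constructor
  · intro x x' h
    refine DFinsupp.ext fun l => Subtype.ext (form₂_injective hs hgen fun w => ?_)
    refine component_induction hn hs hgen
      (p := fun w => form₂ n s w (x l) = form₂ n s w (x' l)) ?_ ?_ w
    · intro i w hw
      by_cases hi : i = l
      · subst hi
        rw [← hform i w hw, ← hform i w hw]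
        exact congrArg _ h
      · rw [form₂_component hn hs hgen hi hw (x l).2, form₂_component hn hs hgen hi hw (x' l).2]
    · intro w w' hw hw'
      rw [map_add, LinearMap.add_apply, LinearMap.add_apply, hw, hw']
  · intro w
    have hw : w ∈ LinearMap.range (DirectSum.coeLinearMap (component (K := K) n s)) := by
      rw [DirectSum.range_coeLinearMap, iSup_component hn hs hgen]
      exact Submodule.mem_top
    exact hw

end decomposition

/-! ### The spectral decomposition -/

section spectral

variable {n : ℕ}

lemma add_right_cancel_of_module {M : Type*} [AddCommMonoid M] [Module K M] {a a' b : M}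
    (h : a + b = a' + b) : a = a' := by
  have hb : b + (-1 : K) • b = 0 := by
    nth_rewrite 1 [← one_smul K b]
    rw [← add_smul, add_neg_cancel, zero_smul]
  rw [← add_zero a, ← add_zero a', ← hb, ← add_assoc, ← add_assoc, h]

lemma rho_succ {s x y : K} (hy : y ≠ 0)
    (hz : ∀ j : ℕ, 0 < j → 1 + (s ^ 2) ^ j * (x / y) ≠ 0) (l : ℕ) :
    rho s (x / y) (l + 1) * (y + (s ^ 2) ^ (l + 1) * x) =
      rho s (x / y) l * (x + (s ^ 2) ^ (l + 1) * y) := by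
  have h := hz (l + 1) (Nat.succ_pos l)
  have e1 : y + (s ^ 2) ^ (l + 1) * x = y * (1 + (s ^ 2) ^ (l + 1) * (x / y)) := by
    field_simp
  have e2 : x + (s ^ 2) ^ (l + 1) * y = y * (x / y + (s ^ 2) ^ (l + 1)) := by
    field_simp
  rw [rho, Finset.prod_Icc_succ_top (by omega), ← rho, e1, e2]
  clear e1 e2 hz
  generalize x / y = z at *
  have h' : 1 + z * (s ^ 2) ^ (l + 1) ≠ 0 := by rwa [mul_comm z]
  field_simp

@[simp] lemma rho_zero (s z : K) : rho s z 0 = 1 := by simp [rho]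

lemma den_ne_zero {s x y : K} (hy : y ≠ 0)
    (hz : ∀ j : ℕ, 0 < j → 1 + (s ^ 2) ^ j * (x / y) ≠ 0) (l : ℕ) :
    y + (s ^ 2) ^ (l + 1) * x ≠ 0 := by
  have h := hz (l + 1) (Nat.succ_pos l)
  contrapose! h
  field_simp
  linear_combination h

/-- The scalar identity behind the lowering part of the intertwining property. -/
lemma rho_pred {s x y : K} (hy : y ≠ 0)
    (hz : ∀ j : ℕ, 0 < j → 1 + (s ^ 2) ^ j * (x / y) ≠ 0) (l : ℕ) :
    rho s (x / y) (l - 1) * (x + (s ^ 2) ^ l * y) = rho s (x / y) l * (y + (s ^ 2) ^ l * x) := by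
  rcases l with - | l
  · simp [add_comm]
  · rw [rho_succ hy hz, Nat.add_sub_cancel]

variable [Algebra ℂ K]

/-- The raising and lowering coefficients change by the factors in the recursion for ρ when x and y
are interchanged; all dependence on z enters here. -/
lemma copE_zero_vhat {s : K} (hs : s ≠ 0) (x y : K) (l : ℕ) :
    creDet s l • copE n s x y 0 (vhat n s l) =
      (((s ^ 2) ^ l)⁻¹ * (y + (s ^ 2) ^ (l + 1) * x)) • upVec n s 1 l +
        (-(x + (s ^ 2) ^ l * y)) • downVec n s 1 l := by
  have hq : (s ^ 2) ^ l ≠ 0 := pow_ne_zero _ (pow_ne_zero _ hs)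
  rw [copE_zero, LinearMap.add_apply, LinearMap.smul_apply, LinearMap.smul_apply, smul_add,
    smul_comm _ y, smul_comm _ x, creR_vhat_eq hs, creL_vhat_eq, smul_add, smul_add,
    add_add_add_comm, smul_smul, smul_smul, smul_smul, smul_smul, ← add_smul, ← add_smul]
  congr 2
  · field_simp
    ring
  · ring

lemma vhat_zero (s : K) : vhat n s 0 = ket K 0 ⊗ₜ ket K 0 := by
  simp [vhat, singCoeff, kk]

lemma fStable_component (s : K) (l : ℕ) : FStable n s 1 (component n s l) :=
  fun _ h1 h2 _ hw => coprodF_mem h1 h2 hw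

lemma upVec_mem (hn : 1 ≤ n) {s : K} (hs : s ≠ 0) (hgen : ∀ k : ℕ, 0 < k → s ^ k ≠ 1) (l : ℕ) :
    upVec n s 1 l ∈ component n s (l + 1) :=
  (fStable_component s _).upVec_mem hn hs hgen le_rfl hn (vhat_mem hs hgen _)

lemma downVec_mem (hn : 1 ≤ n) {s : K} (hs : s ≠ 0) (hgen : ∀ k : ℕ, 0 < k → s ^ k ≠ 1) (l : ℕ) :
    downVec n s 1 l ∈ component n s (l - 1) :=
  (fStable_component s _).downVec_mem hn hs hgen le_rfl hn (vhat_mem hs hgen _)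

lemma copE_zero_comm_coprodF (hn : 1 ≤ n) {s : K} (hs : s ≠ 0) (x y : K) {r : ℕ} (h1 : 1 ≤ r)
    (h2 : r ≤ n) (w : Fock K n ⊗[K] Fock K n) :
    copE n s x y 0 (coprodF n s r w) = coprodF n s r (copE n s x y 0 w) := by
  have hR := LinearMap.congr_fun (creR_comm_coprodF (s := s) le_rfl h1 h2) w
  have hL := LinearMap.congr_fun (creL_comm_coprodF hn hs le_rfl h1 h2) w
  simp only [Module.End.mul_apply] at hR hL
  simp only [copE_zero, LinearMap.add_apply, LinearMap.smul_apply, hR, hL, map_add, map_smul]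

/-! #### Raising operators -/

/-- The operator `e_{n-1} ⋯ e_{n-d}`. -/
def pathE (n : ℕ) (s : K) : ℕ → Module.End K (Fock K n ⊗[K] Fock K n)
  | 0 => 1
  | d + 1 => pathE n s d * copE n s 1 1 (n - (d + 1))

lemma copE_mid_ket (s : K) {r : ℕ} (h1 : 1 ≤ r) (h2 : r < n) (m m' : Fin n → ℕ) :
    copE n s 1 1 r (ket K m ⊗ₜ ket K m') =
      qInt s (site m' r) • ket K m ⊗ₜ[K] ket K (m' - unitVec n r + unitVec n (r + 1)) +
        (qInt s (site m r) * kVal n s r m') •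
          ket K (m - unitVec n r + unitVec n (r + 1)) ⊗ₜ[K] ket K m' := by
  simp [copE, opE_mid s 1 h1 h2, opK_eq, TensorProduct.smul_tmul', smul_smul, mul_comm]

lemma pathE_kkL {s : K} (hs : s ≠ 0) (hgen : ∀ k : ℕ, 0 < k → s ^ k ≠ 1) (a b : ℕ) {d : ℕ}
    (hd : d + 1 < n) :
    pathE n s (d + 1) (kkL K n (n - (d + 1)) a b) = (s ^ 2) ^ b • kk K n (a + 1) b := by
  have e : ∀ (m : Fin n → ℕ) j, m + unitVec n j - unitVec n j = m :=
    fun m j => add_tsub_cancel_right _ _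
  induction d with
  | zero =>
    have h : n - (0 + 1) + 1 = n := by omega
    rw [pathE, pathE, one_mul, kkL, copE_mid_ket s (by omega) (by omega), h, e]
    simp [site_unitVec_ne (show n - 1 ≠ n by omega), -nsmul_eq_mul, kVal,
      site_unitVec_self (show 1 ≤ n - 1 by omega) (show n - 1 ≤ n by omega), qInt_one hs hgen,
      kk, show n - 1 ≠ 0 by omega, show n - 1 ≠ n by omega, add_smul,
      show n - 1 + 1 = n by omega, site_unitVec_self (show 1 ≤ n by omega) le_rfl]
  | succ d ih =>
    obtain ⟨r, hr⟩ : ∃ r, n - (d + 1 + 1) = r := ⟨_, rfl⟩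
    have hr1 : n - (d + 1) = r + 1 := by omega
    have ih := ih (by omega)
    rw [pathE, Module.End.mul_apply, hr, kkL, copE_mid_ket s (by omega) (by omega), e, ← ih, hr1]
    simp [site_unitVec_ne (show r ≠ n by omega), -nsmul_eq_mul, kVal,
      site_unitVec_self (show 1 ≤ r by omega) (show r ≤ n by omega), qInt_one hs hgen,
      kkL, show r ≠ 0 by omega, show r ≠ n by omega, site_unitVec_ne (show r + 1 ≠ n by omega)]

lemma pathE_kkR {s : K} (hs : s ≠ 0) (hgen : ∀ k : ℕ, 0 < k → s ^ k ≠ 1) (a b : ℕ) {d : ℕ}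
    (hd : d + 1 < n) :
    pathE n s (d + 1) (kkR K n (n - (d + 1)) a b) = kk K n a (b + 1) := by
  have e : ∀ (m : Fin n → ℕ) j, m + unitVec n j - unitVec n j = m :=
    fun m j => add_tsub_cancel_right _ _
  induction d with
  | zero =>
    have h : n - (0 + 1) + 1 = n := by omega
    rw [pathE, pathE, one_mul, kkR, copE_mid_ket s (by omega) (by omega), h, e]
    simp [site_unitVec_ne (show n - 1 ≠ n by omega), -nsmul_eq_mul,
      site_unitVec_self (show 1 ≤ n - 1 by omega) (show n - 1 ≤ n by omega), qInt_one hs hgen,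
      kk, add_smul]
  | succ d ih =>
    obtain ⟨r, hr⟩ : ∃ r, n - (d + 1 + 1) = r := ⟨_, rfl⟩
    have hr1 : n - (d + 1) = r + 1 := by omega
    have ih := ih (by omega)
    rw [pathE, Module.End.mul_apply, hr, kkR, copE_mid_ket s (by omega) (by omega), e, ← ih, hr1]
    simp [site_unitVec_ne (show r ≠ n by omega), -nsmul_eq_mul,
      site_unitVec_self (show 1 ≤ r by omega) (show r ≤ n by omega), qInt_one hs hgen, kkR]

/-- Carrying a particle away from site n and back counts particles: the two factors contribute q^b
[a] + [b] q^{-a} = [a + b]. This recovers the singular vector from `upVec`. -/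
lemma pathE_pathF_vhat {s : K} (hs : s ≠ 0) (hgen : ∀ k : ℕ, 0 < k → s ^ k ≠ 1) (l : ℕ) {d : ℕ}
    (hd : d + 1 < n) :
    pathE n s (d + 1) (pathF n s (d + 1) (vhat n s l)) = qInt s l • vhat n s l := by
  simp only [vhat, map_sum, map_smul, Finset.smul_sum]
  refine Finset.sum_congr rfl fun p hp => ?_
  rw [smul_comm, pathF_kk hs hgen _ _ hd, map_add, map_smul, map_smul, pathE_kkL hs hgen _ _ hd,
    pathE_kkR hs hgen _ _ hd, ← Finset.HasAntidiagonal.mem_antidiagonal.mp hp, qInt_add hs,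
    add_smul, smul_smul]
  congr 2
  · rcases p with ⟨- | a, b⟩
    · simp
    · rw [Nat.add_sub_cancel, mul_comm]
  · rcases p with ⟨a, - | b⟩
    · simp
    · rw [Nat.add_sub_cancel]

/-! #### Uniqueness -/

lemma eq_smul_on_component {s : K} {l : ℕ} {c : K} {T : Module.End K (Fock K n ⊗[K] Fock K n)}
    (hF : ∀ r, 1 ≤ r → r ≤ n → ∀ w, T (coprodF n s r w) = coprodF n s r (T w))
    (hv : T (vhat n s l) = c • vhat n s l) {w : Fock K n ⊗[K] Fock K n}
    (hw : w ∈ component n s l) : T w = c • w := by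
  refine component_le (W := LinearMap.eqLocus T (c • LinearMap.id)) ?_ ?_ hw
  · rw [LinearMap.mem_eqLocus, singularVec_eq, map_smul, hv, map_smul]
    rfl
  · intro r h1 h2 w _ hw
    rw [LinearMap.mem_eqLocus] at hw ⊢
    rw [hF r h1 h2, hw]
    simp

/-- The vector e_0 v_l has a part in V_{l-1}, where T is known by induction, so the intertwining
property of e_0 determines T on the part in V_{l+1}. -/
lemma intertwiner_vhat (hn : 1 ≤ n) {s x y : K} (hs : s ≠ 0)
    (hgen : ∀ k : ℕ, 0 < k → s ^ k ≠ 1) (hy : y ≠ 0)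
    (hz : ∀ j : ℕ, 0 < j → 1 + (s ^ 2) ^ j * (x / y) ≠ 0)
    {T : Module.End K (Fock K n ⊗[K] Fock K n)}
    (hF : ∀ r, 1 ≤ r → r ≤ n → ∀ w, T (coprodF n s r w) = coprodF n s r (T w))
    (hE : ∀ r, 1 ≤ r → r ≤ n → ∀ w, T (copE n s 1 1 r w) = copE n s 1 1 r (T w))
    (hE0 : ∀ w, T (copE n s x y 0 w) = copE n s y x 0 (T w))
    (h0 : T (vhat n s 0) = vhat n s 0) (l : ℕ) :
    T (vhat n s l) = rho s (x / y) l • vhat n s l := by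
  induction l using Nat.strong_induction_on with
  | _ l ih =>
  rcases l with - | l
  · rw [h0, rho_zero, one_smul]
  have hdown : T (downVec n s 1 l) = rho s (x / y) (l - 1) • downVec n s 1 l :=
    eq_smul_on_component hF (ih _ (by omega)) (downVec_mem hn hs hgen l)
  have hq : (s ^ 2) ^ l ≠ 0 := pow_ne_zero _ (pow_ne_zero _ hs)
  have hup : T (upVec n s 1 l) = rho s (x / y) (l + 1) • upVec n s 1 l := by
    have h : T (creDet s l • copE n s x y 0 (vhat n s l)) =
        creDet s l • copE n s y x 0 (T (vhat n s l)) := by rw [map_smul, hE0]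
    rw [copE_zero_vhat hs, ih l (by omega), map_smul _ (rho s (x / y) l), smul_comm,
      copE_zero_vhat hs, map_add, map_smul, map_smul, hdown, smul_add,
      smul_smul, smul_smul, smul_smul] at h
    -- By the recursion the lowering parts on both sides are equal and cancel.
    have e : -(x + (s ^ 2) ^ l * y) * rho s (x / y) (l - 1) =
        rho s (x / y) l * -(y + (s ^ 2) ^ l * x) := by
      linear_combination - rho_pred hy hz l
    rw [e] at h
    have h := add_right_cancel_of_module (K := K) h
    have e' : rho s (x / y) l * (((s ^ 2) ^ l)⁻¹ * (x + (s ^ 2) ^ (l + 1) * y)) =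
        ((s ^ 2) ^ l)⁻¹ * (y + (s ^ 2) ^ (l + 1) * x) * rho s (x / y) (l + 1) := by
      linear_combination - ((s ^ 2) ^ l)⁻¹ * rho_succ hy hz l
    rw [e'] at h
    -- The assumption 1 + q^{l+1} z ≠ 0 makes the coefficient of `upVec` nonzero.
    exact smul_right_injective _ (mul_ne_zero (inv_ne_zero hq) (den_ne_zero hy hz l))
      (h.trans (mul_smul _ _ _))
  have hc := qInt_ne_zero hs hgen (Nat.succ_pos l)
  refine smul_right_injective _ hc ?_
  change qInt s (l + 1) • T _ = qInt s (l + 1) • _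
  rw [smul_comm, ← map_smul]
  -- For n = 1, `upVec` is already a multiple of the next singular vector. For n ≥ 2 it is f_1 ⋯
  -- f_{n-1} applied to it, which e_{n-1} ⋯ e_1 undoes up to [l + 1].
  rcases eq_or_lt_of_le hn with rfl | hn1
  · rw [upVec, creation_last_up hn hs hgen] at hup
    exact hup
  · obtain ⟨d, rfl⟩ : ∃ d, n = d + 1 + 1 := ⟨n - 2, by omega⟩
    have h1 : d + 1 + 1 - (d + 1) = 1 := by omega
    have hpath : ∀ c w, c ≤ d + 1 → T (pathE (d + 1 + 1) s c w) = pathE (d + 1 + 1) s c (T w) := by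
      intro c
      induction c with
      | zero => intro w _; rfl
      | succ c ih =>
        intro w hc
        rw [pathE, Module.End.mul_apply, ih _ (by omega), hE _ (by omega) (by omega)]
        rfl
    have hu : upVec (d + 1 + 1) s 1 l = pathF (d + 1 + 1) s (d + 1) (vhat (d + 1 + 1) s (l + 1)) := by
      have := creation_up hs hgen (n := d + 1 + 1) l (d := d) (by omega)
      rw [h1] at this
      exact this
    rw [← pathE_pathF_vhat hs hgen (l + 1) (d := d) (by omega), ← hu, hpath _ _ le_rfl, hup, map_smul]

/-! #### Existence -/

/-- The operator that acts on the summand `V_l` as the scalar `c l`. -/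
def spectralOp {s : K} (hV : DirectSum.IsInternal (component (K := K) n s)) (c : ℕ → K) :
    Module.End K (Fock K n ⊗[K] Fock K n) :=
  DirectSum.toModule K ℕ _ (fun l => c l • (component n s l).subtype) ∘ₗ
    (LinearEquiv.ofBijective (DirectSum.coeLinearMap (component n s)) hV).symm.toLinearMap

lemma spectralOp_apply {s : K} (hV : DirectSum.IsInternal (component (K := K) n s)) (c : ℕ → K)
    {l : ℕ} {w : Fock K n ⊗[K] Fock K n} (hw : w ∈ component n s l) :
    spectralOp hV c w = c l • w := by
  have : (LinearEquiv.ofBijective (DirectSum.coeLinearMap (component n s)) hV).symm w =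
      DirectSum.lof K ℕ (fun l => component n s l) l ⟨w, hw⟩ := by
    rw [LinearEquiv.symm_apply_eq]
    exact (DirectSum.coeLinearMap_lof (component n s) l ⟨w, hw⟩).symm
  rw [spectralOp, LinearMap.comp_apply, LinearEquiv.coe_coe, this, DirectSum.toModule_lof]
  rfl

variable {s : K} (hV : DirectSum.IsInternal (component (K := K) n s)) (c : ℕ → K)

lemma spectralOp_comm (hn : 1 ≤ n) (hs : s ≠ 0) (hgen : ∀ k : ℕ, 0 < k → s ^ k ≠ 1)
    {G : Module.End K (Fock K n ⊗[K] Fock K n)}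
    (hG : ∀ l, ∀ w ∈ component n s l, G w ∈ component n s l) (w : Fock K n ⊗[K] Fock K n) :
    spectralOp hV c (G w) = G (spectralOp hV c w) := by
  have : spectralOp hV c ∘ₗ G = G ∘ₗ spectralOp hV c := component_ext hn hs hgen fun l w hw => by
    rw [LinearMap.comp_apply, LinearMap.comp_apply, spectralOp_apply hV c hw,
      spectralOp_apply hV c (hG l w hw), map_smul]
  exact LinearMap.congr_fun this w

/-- Scalars on mutually orthogonal summands give a self-adjoint operator. -/
lemma form₂_spectralOp (hn : 1 ≤ n) (hs : s ≠ 0) (hgen : ∀ k : ℕ, 0 < k → s ^ k ≠ 1)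
    (u v : Fock K n ⊗[K] Fock K n) :
    form₂ n s (spectralOp hV c u) v = form₂ n s u (spectralOp hV c v) := by
  have : form₂ n s ∘ₗ spectralOp hV c = LinearMap.lcomp K K (spectralOp hV c) ∘ₗ form₂ n s := by
    refine component_ext hn hs hgen fun l u hu => component_ext hn hs hgen fun l' v hv => ?_
    rw [LinearMap.comp_apply, LinearMap.comp_apply, LinearMap.lcomp_apply,
      spectralOp_apply hV c hu, spectralOp_apply hV c hv, map_smul, map_smul, LinearMap.smul_apply]
    by_cases hl : l = l'
    · rw [hl]
    · rw [form₂_component hn hs hgen hl hu hv, smul_zero, smul_zero]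
  exact LinearMap.congr_fun₂ this u v

variable {x y : K}

lemma spectralOp_copE_zero (hn : 1 ≤ n) (hs : s ≠ 0) (hgen : ∀ k : ℕ, 0 < k → s ^ k ≠ 1)
    (hy : y ≠ 0) (hz : ∀ j : ℕ, 0 < j → 1 + (s ^ 2) ^ j * (x / y) ≠ 0)
    (w : Fock K n ⊗[K] Fock K n) :
    spectralOp hV (rho s (x / y)) (copE n s x y 0 w) =
      copE n s y x 0 (spectralOp hV (rho s (x / y)) w) := by
  set T := spectralOp hV (rho s (x / y)) with hT
  have hF : ∀ r, 1 ≤ r → r ≤ n → ∀ w, T (coprodF n s r w) = coprodF n s r (T w) :=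
    fun r h1 h2 => spectralOp_comm hV _ hn hs hgen fun l w hw => coprodF_mem h1 h2 hw
  have hv : ∀ l, T (copE n s x y 0 (vhat n s l)) = copE n s y x 0 (T (vhat n s l)) := by
    intro l
    refine smul_right_injective _ (creDet_ne_zero hs hgen l) ?_
    change creDet s l • _ = creDet s l • _
    rw [← map_smul, copE_zero_vhat hs, hT, spectralOp_apply hV _ (vhat_mem hs hgen l), map_smul,
      smul_comm, copE_zero_vhat hs, map_add, map_smul, map_smul,
      spectralOp_apply hV _ (upVec_mem hn hs hgen l),
      spectralOp_apply hV _ (downVec_mem hn hs hgen l), smul_add, smul_smul, smul_smul, smul_smul,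
      smul_smul]
    congr 2
    · linear_combination ((s ^ 2) ^ l)⁻¹ * rho_succ hy hz l
    · linear_combination - rho_pred hy hz l
  have : T ∘ₗ copE n s x y 0 = copE n s y x 0 ∘ₗ T := by
    refine component_ext hn hs hgen fun l w hw => ?_
    rw [LinearMap.comp_apply, LinearMap.comp_apply]
    refine component_le (W := LinearMap.eqLocus (T ∘ₗ copE n s x y 0) (copE n s y x 0 ∘ₗ T))
      ?_ ?_ hw
    · rw [LinearMap.mem_eqLocus, LinearMap.comp_apply, LinearMap.comp_apply, singularVec_eq]
      simp only [map_smul, hv]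
    · intro r h1 h2 w _ hw
      rw [LinearMap.mem_eqLocus, LinearMap.comp_apply, LinearMap.comp_apply] at hw ⊢
      rw [copE_zero_comm_coprodF hn hs x y h1 h2, hF r h1 h2, hw, hF r h1 h2,
        copE_zero_comm_coprodF hn hs y x h1 h2]
  exact LinearMap.congr_fun this w

/-- This is the transpose of the relation for e_0: f_0 k_0 with parameters (x, y) is, up to a
scalar, the transpose of e_0 with parameters (y, x), and T is self-adjoint. -/
lemma spectralOp_copF_zero (hn : 1 ≤ n) (hs : s ≠ 0) (hgen : ∀ k : ℕ, 0 < k → s ^ k ≠ 1)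
    (hx : x ≠ 0) (hy : y ≠ 0) (hz : ∀ j : ℕ, 0 < j → 1 + (s ^ 2) ^ j * (x / y) ≠ 0)
    (w : Fock K n ⊗[K] Fock K n) :
    spectralOp hV (rho s (x / y)) (copF n s x y 0 w) =
      copF n s y x 0 (spectralOp hV (rho s (x / y)) w) := by
  set T := spectralOp hV (rho s (x / y)) with hT
  have hK : ∀ w, T (dg₂ (kVal n s 0) w) = dg₂ (kVal n s 0) (T w) :=
    spectralOp_comm hV _ hn hs hgen fun l w hw => (kVal_shift hn hs).dg₂_mem hn hw
  -- The transpose of e_0 is f_0 k_0 rather than f_0, so the argument is written as k_0 v.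
  obtain ⟨v, rfl⟩ : ∃ v, dg₂ (kVal n s 0) v = w :=
    ⟨_, dg₂_mul_dg₂_inv (kVal_ne_zero hs 0) w⟩
  refine form₂_injective hs hgen fun u => ?_
  have hc : x * y * adjCoeff n s 0 ≠ 0 :=
    mul_ne_zero (mul_ne_zero hx hy) (adjCoeff_ne_zero hs hgen 0)
  refine mul_left_cancel₀ hc ?_
  have h1 := form₂_copE hn hs hgen hx hy (Nat.zero_le n) u (T v)
  have h2 := form₂_copE hn hs hgen hy hx (Nat.zero_le n) (T u) v
  rw [if_pos rfl] at h1 h2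
  rw [hK, ← h1, ← form₂_spectralOp hV _ hn hs hgen, ← form₂_spectralOp hV _ hn hs hgen, ← hT,
    mul_comm x y, ← h2, hT, spectralOp_copE_zero hV hn hs hgen hy hz]

end spectral

/-! ### The quantum `R` matrix and the intertwiner `P R` -/

section intertwiner

variable {n : ℕ}

/-- The interchange `P` of the two factors. -/
def swap (K : Type*) [Field K] (n : ℕ) : Module.End K (Fock K n ⊗[K] Fock K n) :=
  (TensorProduct.comm K (Fock K n) (Fock K n)).toLinearMap

lemma swap_map (f g : Module.End K (Fock K n)) (w : Fock K n ⊗[K] Fock K n) :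
    swap K n (TensorProduct.map f g w) = TensorProduct.map g f (swap K n w) :=
  (TensorProduct.map_comm g f w).symm

lemma swap_swap (w : Fock K n ⊗[K] Fock K n) : swap K n (swap K n w) = w :=
  (TensorProduct.comm K (Fock K n) (Fock K n)).symm_apply_apply w

variable [Algebra ℂ K] {s x y : K}

/-- The properties of `P R` that correspond to those of the quantum `R` matrix. -/
structure IsIntertwiner (n : ℕ) (s x y : K) (T : Module.End K (Fock K n ⊗[K] Fock K n)) :
    Prop where
  k_comm : ∀ r ≤ n, ∀ w, T (dg₂ (kVal n s r) w) = dg₂ (kVal n s r) (T w)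
  e_comm : ∀ r ≤ n, ∀ w, T (copE n s x y r w) = copE n s y x r (T w)
  f_comm : ∀ r ≤ n, ∀ w, T (copF n s x y r w) = copF n s y x r (T w)
  normalized : T (vhat n s 0) = vhat n s 0

/-- Composing with P exchanges the tensor factors, so Δ' on V_x ⊗ V_y becomes Δ on V_y ⊗ V_x. -/
lemma IsQuantumR.isIntertwiner {R : Module.End K (Fock K n ⊗[K] Fock K n)}
    (h : IsQuantumR n s x y R) : IsIntertwiner n s x y (swap K n ∘ₗ R) where
  k_comm r hr w := by
    have := LinearMap.congr_fun (h.k_comm r hr) w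
    rw [LinearMap.comp_apply, LinearMap.comp_apply] at this
    rw [LinearMap.comp_apply, ← map_opK, ← this, swap_map]
    rfl
  e_comm r hr w := by
    have := LinearMap.congr_fun (h.e_comm r hr) w
    rw [LinearMap.comp_apply, LinearMap.comp_apply] at this
    rw [LinearMap.comp_apply, copE, ← this, LinearMap.add_apply, map_add, swap_map, swap_map]
    rfl
  f_comm r hr w := by
    have := LinearMap.congr_fun (h.f_comm r hr) w
    rw [LinearMap.comp_apply, LinearMap.comp_apply] at this
    rw [LinearMap.comp_apply, copF, ← this, LinearMap.add_apply, map_add, swap_map, swap_map]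
    rfl
  normalized := by
    rw [LinearMap.comp_apply, vhat_zero, h.normalized]
    rfl

lemma IsIntertwiner.isQuantumR {T : Module.End K (Fock K n ⊗[K] Fock K n)}
    (h : IsIntertwiner n s x y T) : IsQuantumR n s x y (swap K n ∘ₗ T) where
  k_comm r hr := LinearMap.ext fun w => by
    rw [LinearMap.comp_apply, LinearMap.comp_apply, LinearMap.comp_apply, LinearMap.comp_apply,
      map_opK, h.k_comm r hr, ← map_opK, swap_map]
  e_comm r hr := LinearMap.ext fun w => by
    have := h.e_comm r hr w
    rw [copE] at this
    rw [LinearMap.comp_apply, LinearMap.comp_apply, LinearMap.comp_apply, LinearMap.comp_apply,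
      this, copE, LinearMap.add_apply, LinearMap.add_apply, map_add, swap_map, swap_map]
  f_comm r hr := LinearMap.ext fun w => by
    have := h.f_comm r hr w
    rw [copF] at this
    rw [LinearMap.comp_apply, LinearMap.comp_apply, LinearMap.comp_apply, LinearMap.comp_apply,
      this, copF, LinearMap.add_apply, LinearMap.add_apply, map_add, swap_map, swap_map]
  normalized := by
    rw [LinearMap.comp_apply, ← vhat_zero s, h.normalized, vhat_zero]
    rfl

lemma IsIntertwiner.apply_component (hn : 1 ≤ n) (hs : s ≠ 0)
    (hgen : ∀ k : ℕ, 0 < k → s ^ k ≠ 1) (hy : y ≠ 0)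
    (hz : ∀ j : ℕ, 0 < j → 1 + (s ^ 2) ^ j * (x / y) ≠ 0)
    {T : Module.End K (Fock K n ⊗[K] Fock K n)} (h : IsIntertwiner n s x y T) {l : ℕ}
    {w : Fock K n ⊗[K] Fock K n} (hw : w ∈ component n s l) : T w = rho s (x / y) l • w := by
  have hF : ∀ r, 1 ≤ r → r ≤ n → ∀ w, T (coprodF n s r w) = coprodF n s r (T w) := by
    intro r h1 h2 w
    have := h.f_comm r h2 w
    rwa [copF_param s x y h1, copF_param s y x h1] at this
  have hE : ∀ r, 1 ≤ r → r ≤ n → ∀ w, T (copE n s 1 1 r w) = copE n s 1 1 r (T w) := by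
    intro r h1 h2 w
    have := h.e_comm r h2 w
    rwa [copE_param s x y h1, copE_param s y x h1] at this
  exact eq_smul_on_component hF (intertwiner_vhat hn hs hgen hy hz hF hE
    (h.e_comm 0 (Nat.zero_le n)) h.normalized l) hw

lemma isIntertwiner_spectralOp (hn : 1 ≤ n) (hs : s ≠ 0) (hgen : ∀ k : ℕ, 0 < k → s ^ k ≠ 1)
    (hx : x ≠ 0) (hy : y ≠ 0) (hz : ∀ j : ℕ, 0 < j → 1 + (s ^ 2) ^ j * (x / y) ≠ 0)
    (hV : DirectSum.IsInternal (component (K := K) n s)) :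
    IsIntertwiner n s x y (spectralOp hV (rho s (x / y))) where
  k_comm r _ := spectralOp_comm hV _ hn hs hgen fun l w hw => (kVal_shift hn hs).dg₂_mem hn hw
  e_comm r hr := by
    rcases Nat.eq_zero_or_pos r with rfl | h1
    · exact spectralOp_copE_zero hV hn hs hgen hy hz
    · rw [copE_param s x y h1, copE_param s y x h1]
      exact spectralOp_comm hV _ hn hs hgen fun l w hw => copE_mem hn hs hgen h1 hr hw
  f_comm r hr := by
    rcases Nat.eq_zero_or_pos r with rfl | h1
    · exact spectralOp_copF_zero hV hn hs hgen hx hy hz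
    · rw [copF_param s x y h1, copF_param s y x h1]
      exact spectralOp_comm hV _ hn hs hgen fun l w hw => coprodF_mem h1 hr hw
  normalized := by
    rw [spectralOp_apply hV _ (vhat_mem hs hgen 0), rho_zero, one_smul]

end intertwiner

/-! ### Vectors as finite sums of their projections -/

lemma projector_support_finite {M : Type*} [AddCommMonoid M] [Module K M] {W : ℕ → Submodule K M}
    (hW : DirectSum.IsInternal W) (w : M) :
    (Function.support fun l : ℕ => projector hW l w).Finite := by
  classical
  obtain ⟨x, hx⟩ : ∃ x, (LinearEquiv.ofBijective (DirectSum.coeLinearMap W) hW).symm w = x :=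
    ⟨_, rfl⟩
  refine (DFinsupp.support x).finite_toSet.subset fun l hl => ?_
  rw [Finset.mem_coe, DFinsupp.mem_support_toFun]
  intro h0
  refine hl ?_
  change ((LinearEquiv.ofBijective (DirectSum.coeLinearMap W) hW).symm w l : M) = 0
  rw [hx, h0]
  rfl

lemma eq_finsum_projector {M N : Type*} [AddCommMonoid M] [Module K M] [AddCommMonoid N]
    [Module K N] {W : ℕ → Submodule K M} (hW : DirectSum.IsInternal W) (f : M →ₗ[K] N) (w : M) :
    f w = ∑ᶠ l : ℕ, f (projector hW l w) := by
  classical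
  obtain ⟨x, hx⟩ : ∃ x, (LinearEquiv.ofBijective (DirectSum.coeLinearMap W) hW).symm w = x :=
    ⟨_, rfl⟩
  have hp : ∀ l, projector hW l w = x l := fun l => by rw [← hx]; rfl
  have hw : w = DirectSum.coeLinearMap W x := by
    rw [LinearEquiv.symm_apply_eq] at hx
    exact hx
  have hsum : w = ∑ l ∈ DFinsupp.support x, (x l : M) := by
    rw [hw, DirectSum.coeLinearMap_eq_dfinsuppSum]
    rfl
  simp only [hp]
  rw [finsum_eq_sum_of_support_subset (s := DFinsupp.support x), ← map_sum, ← hsum]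
  intro l hl
  rw [Finset.mem_coe, DFinsupp.mem_support_toFun]
  intro h0
  refine hl ?_
  change f (x l) = 0
  rw [h0, Submodule.coe_zero, map_zero]

lemma projector_mem {M : Type*} [AddCommMonoid M] [Module K M] {W : ℕ → Submodule K M}
    (hW : DirectSum.IsInternal W) (l : ℕ) (w : M) : projector hW l w ∈ W l :=
  Submodule.coe_mem _

end QOsc

end

theorem proposition3p6 {K : Type*} [Field K] [Algebra ℂ K] (n : ℕ) (hn : 1 ≤ n)
    (s x y : K) (hs : s ≠ 0) (hgen : ∀ k : ℕ, 0 < k → s ^ k ≠ 1)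
    (hx : x ≠ 0) (hy : y ≠ 0)
    (hz : ∀ j : ℕ, 0 < j → 1 + (s ^ 2) ^ j * (x / y) ≠ 0) :
    (∃! R : Module.End K (TensorProduct K (QOsc.Fock K n) (QOsc.Fock K n)),
      QOsc.IsQuantumR n s x y R) ∧
    ∃ hV : DirectSum.IsInternal (QOsc.component (K := K) n s),
      ∀ R : Module.End K (TensorProduct K (QOsc.Fock K n) (QOsc.Fock K n)),
        QOsc.IsQuantumR n s x y R →
        ∀ w : TensorProduct K (QOsc.Fock K n) (QOsc.Fock K n),
          (Function.support fun l : ℕ => QOsc.projector hV l w).Finite ∧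
          QOsc.swapComp R w =
            ∑ᶠ l : ℕ, QOsc.rho s (x / y) l • QOsc.projector hV l w := by
  have hV := QOsc.isInternal_component (K := K) hn hs hgen
  have key : ∀ R : Module.End K (TensorProduct K (QOsc.Fock K n) (QOsc.Fock K n)),
      QOsc.IsQuantumR n s x y R → ∀ l, ∀ w ∈ QOsc.component n s l,
        QOsc.swapComp R w = QOsc.rho s (x / y) l • w :=
    fun R hR l w hw => hR.isIntertwiner.apply_component hn hs hgen hy hz hw
  refine ⟨⟨_, (QOsc.isIntertwiner_spectralOp hn hs hgen hx hy hz hV).isQuantumR, ?_⟩, hV, ?_⟩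
  · intro R hR
    -- Any R has PR = ρ_l on V_l; applying P once more, with P² = 1, determines R.
    refine QOsc.component_ext hn hs hgen fun l w hw => ?_
    have h := congrArg (QOsc.swap K n) (key R hR l w hw)
    rw [LinearMap.comp_apply, QOsc.spectralOp_apply hV _ hw, ← h]
    exact (QOsc.swap_swap _).symm
  · intro R hR w
    refine ⟨QOsc.projector_support_finite hV w, ?_⟩
    rw [QOsc.eq_finsum_projector hV (QOsc.swapComp R) w]
    exact finsum_congr fun l => key R hR l _ (QOsc.projector_mem hV l w)
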